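/- Let $K$ be a field, $n\ge 1$, and let $Q=\tilde A_n$ be the cyclically oriented quiver with vertices $v_1,\dots,v_n$ and arrows $v_1\to v_2\to\cdots\to v_n\to v_1$. Paths are composed like functions, so a left $KQ$-module $M$ has for each arrow $a\to b$ a linear map $e_aM\to e_bM$. Let $J$ be the ideal of $KQ$ generated by the arrows, and let $\mathcal E_n$ be the category of finite-dimensional left $KQ$-modules $M$ with $J^NM=0$ for some $N$. Let $S_v$ be the simple module at the vertex $v$. A torsion pair on $\mathcal E_n$ is a pair $(\mathcal T,\mathcal F)$ of full subcategories of $\mathcal E_n$, closed under isomorphism, such that $\operatorname{Hom}(X,Y)=0$ for all $X\in\mathcal T$, $Y\in\mathcal F$, and every $X\in\mathcal E_n$ has an exact sequence $0\to X_{\mathcal T}\to X\to X_{\mathcal F}\to 0$ with $X_{\mathcal T}\in\mathcal T$, $X_{\mathcal F}\in\mathcal F$. Let $L_{\mathcal T}$ be the set of vertices $v$ such that $\mathcal T$ contains infinitely many indecomposable modules, up to isomorphism, with top $S_v$, and $R_{\mathcal F}$ the set of vertices $v$ such that $\mathcal F$ contains infinitely many indecomposable modules, up to isomorphism, with socle $S_v$.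 Consider tuples $(\Delta_0,\Delta_1,\dots,\Delta_m)$, $m\ge 0$, of pairwise disjoint sets of vertices of $Q$ with $\Delta_1,\dots,\Delta_m$ nonempty. For $0\le j\le m$ put $Q_j=Q_0\setminus(\Delta_0\cup\dots\cup\Delta_{j-1})$, where $Q_0$ is the set of all vertices. The tuple is complete if $\Delta_0\cup\dots\cup\Delta_m$ is the set of all vertices. It is a strong 1-type part partition if, for every $1\le j\le m$, $\Delta_j$ contains all sinks (for $j$ odd), respectively all sources (for $j$ even), of the full subquiver on $Q_j$. It is a strong 2-type part partition if the same holds with sinks and sources exchanged. Let $\operatorname{Coray}_j$ (respectively $\operatorname{Ray}_j$) be the class of modules in $\mathcal E_n$ that are supported on $Q_j$ and whose top (respectively socle) is a finite direct sum of modules $S_v$ with $v\in\Delta_j$. For classes of modules, $\langle\dots\rangle$ denotes the smallest full subcategory that contains them and the zero modules and is closed under extensions. (1) There is a bijection from the set of torsion pairs $(\mathcal T,\mathcal F)$ on $\mathcal E_n$ with $L_{\mathcal T}\neq\emptyset$ to the set of complete strong 1-type part partitions $(\Delta_0,\dots,\Delta_m)$ of $\tilde A_n$ with $\Delta_0\neq\emptyset$.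 Under it, $\Delta_0=L_{\mathcal T}$, $\mathcal T=\langle \operatorname{Coray}_j : j \text{ even}\rangle$ and $\mathcal F=\langle\operatorname{Ray}_j : j\text{ odd}\rangle$. (2) There is a bijection from the set of torsion pairs $(\mathcal T,\mathcal F)$ on $\mathcal E_n$ with $R_{\mathcal F}\neq\emptyset$ to the set of complete strong 2-type part partitions $(\Delta_0,\dots,\Delta_m)$ of $\tilde A_n$ with $\Delta_0\neq\emptyset$. Under it, $\Delta_0=R_{\mathcal F}$, $\mathcal T=\langle \operatorname{Coray}_j : j \text{ odd}\rangle$ and $\mathcal F=\langle\operatorname{Ray}_j : j\text{ even}\rangle$. -/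

import Mathlib

open CategoryTheory CategoryTheory.Limits

universe u

namespace QuiverTorsion

/-! ### Path algebras -/

section PathAlgebra

variable (K : Type u) [Field K] (V : Type) [Quiver.{0} V] [Fintype V]

/-- Generators of a path algebra: a trivial path `e_v` for each vertex `v`, and the arrows. -/
inductive PathGen : Type
  | vertex (v : V) : PathGen
  | arrow {a b : V} (f : a ⟶ b) : PathGen

/-- Relations of the path algebra of a quiver with finitely many vertices. An arrow `f : a ⟶ b`
satisfies `f = e_b f e_a`, so paths are composed like functions and a left module has for each arrow
`f : a ⟶ b` a linear map from `e_a M` to `e_b M`. -/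
inductive PathRel : FreeAlgebra K (PathGen V) → FreeAlgebra K (PathGen V) → Prop
  | idem (v : V) :
      PathRel (FreeAlgebra.ι K (.vertex v) * FreeAlgebra.ι K (.vertex v))
        (FreeAlgebra.ι K (.vertex v))
  | orth (v w : V) (h : v ≠ w) :
      PathRel (FreeAlgebra.ι K (.vertex v) * FreeAlgebra.ι K (.vertex w)) 0
  | sum : PathRel (∑ v : V, FreeAlgebra.ι K (.vertex v)) 1
  | arrow {a b : V} (f : a ⟶ b) :
      PathRel
        (FreeAlgebra.ι K (.vertex b) * FreeAlgebra.ι K (.arrow f) * FreeAlgebra.ι K (.vertex a))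
        (FreeAlgebra.ι K (.arrow f))

/-- The path algebra `K Q` of a quiver with finitely many vertices. -/
def PathAlgebra : Type u := RingQuot (PathRel K V)

noncomputable instance : Ring (PathAlgebra K V) := inferInstanceAs (Ring (RingQuot (PathRel K V)))

noncomputable instance : Algebra K (PathAlgebra K V) :=
  inferInstanceAs (Algebra K (RingQuot (PathRel K V)))

/-- The projection from the free algebra on the generators. -/
noncomputable def PathAlgebra.mk : FreeAlgebra K (PathGen V) →ₐ[K] PathAlgebra K V :=
  RingQuot.mkAlgHom K (PathRel K V)

variable {V}

/-- The idempotent `e_v`. -/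
noncomputable def idem (v : V) : PathAlgebra K V :=
  PathAlgebra.mk K V (FreeAlgebra.ι K (.vertex v))

/-- The element of the path algebra given by an arrow. -/
noncomputable def arrowElt {a b : V} (f : a ⟶ b) : PathAlgebra K V :=
  PathAlgebra.mk K V (FreeAlgebra.ι K (.arrow f))

open Classical in
/-- The character of the path algebra by which it acts on the simple module at `v`:
it sends `e_v` to `1`, and all other `e_w` and all arrows to `0`. -/
noncomputable def character (v : V) : PathAlgebra K V →ₐ[K] K :=
  RingQuot.liftAlgHom K
    ⟨FreeAlgebra.lift K fun g : PathGen V => match g with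
        | .vertex w => if w = v then 1 else 0
        | .arrow _ => 0, by
      intro x y h
      cases h with
      | idem w => simp
      | orth w w' h =>
        simp only [map_mul, FreeAlgebra.lift_ι_apply, map_zero]
        by_cases h1 : w = v <;> by_cases h2 : w' = v <;> simp_all
      | sum => simp
      | arrow f => simp⟩

/-- The simple module `S_v` concentrated at the vertex `v`. -/
def SimpleAt (_ : V) : Type u := K

instance (v : V) : AddCommGroup (SimpleAt K v) := inferInstanceAs (AddCommGroup K)

noncomputable instance (v : V) : Module (PathAlgebra K V) (SimpleAt K v) :=
  Module.compHom K (character K v : PathAlgebra K V →+* K)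

variable (V)

/-- The two-sided ideal `J` generated by all arrows. -/
noncomputable def arrowIdeal : Ideal (PathAlgebra K V) :=
  (TwoSidedIdeal.span {x | ∃ (a b : V) (f : a ⟶ b), x = arrowElt K f}).asIdeal

open scoped ModuleCat in
/-- Ordinary modules: finite-dimensional modules killed by a power of `J`. -/
def IsOrdinary : ObjectProperty (ModuleCat.{u} (PathAlgebra K V)) := fun M =>
  FiniteDimensional K M ∧
    ∃ N : ℕ, arrowIdeal K V ^ N • (⊤ : Submodule (PathAlgebra K V) M) = ⊥

end PathAlgebra

/-! ### Socles, tops, rays and corays -/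

section Modules

variable {K : Type u} [Field K] {V : Type} [Quiver.{0} V] [Fintype V]

/-- The socle: the sum of all simple submodules. -/
def socle (A M : Type*) [Ring A] [AddCommGroup M] [Module A M] : Submodule A M :=
  sSup {N | IsSimpleModule A N}

/-- The top: the quotient by the radical (the intersection of all maximal submodules). -/
abbrev TopQuotient (A M : Type*) [Ring A] [AddCommGroup M] [Module A M] : Type _ :=
  M ⧸ Module.jacobson A M

/-- `X` is isomorphic to a finite direct sum of simple modules `S_v` with `v ∈ D`. -/
def IsSumOfSimples (D : Set V) (X : Type*) [AddCommGroup X] [Module (PathAlgebra K V) X] : Prop :=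
  ∃ (k : ℕ) (f : Fin k → V), (∀ j, f j ∈ D) ∧
    Nonempty (X ≃ₗ[PathAlgebra K V] ((j : Fin k) → SimpleAt K (f j)))

/-- `M` is supported on the vertex set `R`, i.e. `M` is a module over the path algebra of the full
subquiver on `R`. -/
def IsSupportedOn (R : Set V) (M : ModuleCat.{u} (PathAlgebra K V)) : Prop :=
  ∀ v, v ∉ R → ∀ x : M, idem K v • x = 0

/-- Ordinary modules over the full subquiver on `R` whose socle is a sum of simples at vertices
of `D`. -/
def Ray (R D : Set V) : ObjectProperty (ModuleCat.{u} (PathAlgebra K V)) := fun M =>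
  IsOrdinary K V M ∧ IsSupportedOn R M ∧ IsSumOfSimples (K := K) D (socle (PathAlgebra K V) M)

/-- Ordinary modules over the full subquiver on `R` whose top is a sum of simples at vertices
of `D`. -/
def Coray (R D : Set V) : ObjectProperty (ModuleCat.{u} (PathAlgebra K V)) := fun M =>
  IsOrdinary K V M ∧ IsSupportedOn R M ∧ IsSumOfSimples (K := K) D (TopQuotient (PathAlgebra K V) M)

/-- `L_P`: the vertices `v` such that `P` contains infinitely many indecomposable modules,
up to isomorphism, with top `S_v`. -/
def leftVertices (P : ObjectProperty (ModuleCat.{u} (PathAlgebra K V))) : Set V :=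
  {v | {c : Quotient (isIsomorphicSetoid (ModuleCat.{u} (PathAlgebra K V))) |
    ∃ M, c = ⟦M⟧ ∧ P M ∧ Indecomposable M ∧
      Nonempty (TopQuotient (PathAlgebra K V) M ≃ₗ[PathAlgebra K V] SimpleAt K v)}.Infinite}

/-- `R_P`: the vertices `v` such that `P` contains infinitely many indecomposable modules,
up to isomorphism, with socle `S_v`. -/
def rightVertices (P : ObjectProperty (ModuleCat.{u} (PathAlgebra K V))) : Set V :=
  {v | {c : Quotient (isIsomorphicSetoid (ModuleCat.{u} (PathAlgebra K V))) |
    ∃ M, c = ⟦M⟧ ∧ P M ∧ Indecomposable M ∧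
      Nonempty (socle (PathAlgebra K V) M ≃ₗ[PathAlgebra K V] SimpleAt K v)}.Infinite}

end Modules

/-! ### Torsion pairs and extension closures -/

section Torsion

variable {A : Type u} [Ring A]

/-- Torsion pairs on a full subcategory `C` of a module category; the two classes are full
subcategories closed under isomorphism. -/
structure TorsionPair (C : ObjectProperty (ModuleCat.{u} A)) where
  T : ObjectProperty (ModuleCat.{u} A)
  F : ObjectProperty (ModuleCat.{u} A)
  le_T : T ≤ C
  le_F : F ≤ C
  iso_T : T.IsClosedUnderIsomorphisms
  iso_F : F.IsClosedUnderIsomorphisms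
  hom_zero : ∀ X Y : ModuleCat.{u} A, T X → F Y → ∀ f : X ⟶ Y, f = 0
  exists_seq : ∀ X, C X → ∃ S : ShortComplex (ModuleCat.{u} A),
    S.ShortExact ∧ T S.X₁ ∧ S.X₂ = X ∧ F S.X₃

/-- The smallest full subcategory that contains `P` and the zero modules and is closed under
extensions (hence under isomorphisms). -/
inductive ExtClosure (P : ObjectProperty (ModuleCat.{u} A)) : ModuleCat.{u} A → Prop
  | of (X : ModuleCat.{u} A) (h : P X) : ExtClosure P X
  | zero (X : ModuleCat.{u} A) (h : IsZero X) : ExtClosure P X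
  | ext (S : ShortComplex (ModuleCat.{u} A)) (hS : S.ShortExact)
      (h₁ : ExtClosure P S.X₁) (h₃ : ExtClosure P S.X₃) : ExtClosure P S.X₂

end Torsion

/-! ### Part partitions -/

/-- A tuple `(Δ_0, Δ_1, …, Δ_m)` of pairwise disjoint vertex sets with `Δ_1, …, Δ_m` nonempty. -/
@[ext]
structure PartTuple (V : Type) where
  m : ℕ
  part : Fin (m + 1) → Set V
  disjoint : ∀ i j, i ≠ j → Disjoint (part i) (part j)
  nonempty : ∀ i, i ≠ 0 → (part i).Nonempty

/-- `v` is a sink of the full subquiver on `R`. -/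
def IsSinkIn {V : Type} [Quiver.{0} V] (R : Set V) (v : V) : Prop :=
  v ∈ R ∧ ∀ w ∈ R, IsEmpty (v ⟶ w)

/-- `v` is a source of the full subquiver on `R`. -/
def IsSourceIn {V : Type} [Quiver.{0} V] (R : Set V) (v : V) : Prop :=
  v ∈ R ∧ ∀ w ∈ R, IsEmpty (w ⟶ v)

namespace PartTuple

variable {V : Type} (S : PartTuple V)

/-- The vertices that remain after removing `Δ_0, …, Δ_{j-1}`. -/
def rest (j : Fin (S.m + 1)) : Set V := {v | ∀ i, i < j → v ∉ S.part i}

def IsComplete : Prop := ∀ v, ∃ i, v ∈ S.part i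

/-- Strong 1-type: for `j ≥ 1`, `Δ_j` contains all sinks (`j` odd) or all sources (`j` even) of the
full subquiver on the complement of `Δ_0 ∪ … ∪ Δ_{j-1}`. -/
def IsStrongOne [Quiver.{0} V] : Prop :=
  ∀ j : Fin (S.m + 1), j ≠ 0 →
    (Odd j.val → ∀ v, IsSinkIn (S.rest j) v → v ∈ S.part j) ∧
    (Even j.val → ∀ v, IsSourceIn (S.rest j) v → v ∈ S.part j)

/-- Strong 2-type: sinks and sources are exchanged. -/
def IsStrongTwo [Quiver.{0} V] : Prop :=
  ∀ j : Fin (S.m + 1), j ≠ 0 →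
    (Odd j.val → ∀ v, IsSourceIn (S.rest j) v → v ∈ S.part j) ∧
    (Even j.val → ∀ v, IsSinkIn (S.rest j) v → v ∈ S.part j)

variable (K : Type u) [Field K] [Quiver.{0} V] [Fintype V]

/-- The union of the corays of `Δ_j` over the subquivers on `rest j`, for `j` with `p j`. -/
def corays (p : ℕ → Prop) : ObjectProperty (ModuleCat.{u} (PathAlgebra K V)) := fun M =>
  ∃ j : Fin (S.m + 1), p j.val ∧ Coray (S.rest j) (S.part j) M

/-- The union of the rays of `Δ_j` over the subquivers on `rest j`, for `j` with `p j`. -/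
def rays (p : ℕ → Prop) : ObjectProperty (ModuleCat.{u} (PathAlgebra K V)) := fun M =>
  ∃ j : Fin (S.m + 1), p j.val ∧ Ray (S.rest j) (S.part j) M

end PartTuple

/-! ### The cyclic quiver -/

/-- The vertices of the cyclically oriented quiver with `n` vertices. -/
def CyclicQuiver (n : ℕ) : Type := Fin n

instance (n : ℕ) : Fintype (CyclicQuiver n) := inferInstanceAs (Fintype (Fin n))

/-- There is exactly one arrow from `a` to `a + 1` (modulo `n`), and there are no other arrows. -/
instance (n : ℕ) [NeZero n] : Quiver.{0} (CyclicQuiver n) where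
  Hom a b := PLift (@Eq (Fin n) b ((show Fin n from a) + 1))

end QuiverTorsion

/-! Write a for `arrowSum K n`. The path algebra is generated over K by the idempotents and a, and a
is normal, so everything about an ordinary module is read off from one nilpotent operator that
shifts vertices by one. The socle is the kernel of a and the radical is its image. Hence a coray is
a module generated by its elements at D, and a ray is a module whose kernel of a sits at D. The test
objects are the uniserial modules (`IsChain`), given by a starting vertex and a length.

From a torsion pair to a tuple. A vertex v lies in L_T exactly when every module generated at v is
torsion, because T then contains arbitrarily long uniserials with top at v and these map onto every
cyclic module generated at v; R_F is dual. So Δ_0 is the first step of a greedy process: on the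
remaining vertices R, alternately remove those v whose corays over R all lie in T, and those whose
rays over R all lie in F. After one step of either kind, the sinks, respectively sources, of what
remains qualify for the next step (`ray_le_F_of_sink`, `coray_le_T_of_source`). As Δ_0 is nonempty,
the cycle is cut, so every nonempty remainder has a sink and a source. Therefore each later part is
nonempty, the process exhausts the vertices, and the resulting tuple is strong.

From a tuple to a torsion pair. Corays of torsion index and rays of the other indices are
Hom-orthogonal (`hom_eq_zero_of_corays_of_rays`). Every ordinary module is split by peeling off,
part by part, the submodule generated at Δ_j or the largest quotient with socle at Δ_j
(`exists_submodule`). So the extension closures form a torsion pair, and any torsion pair containing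
these corays and rays equals it (`eq_extClosure`).

Uniqueness. Strongness forces a tuple to be the greedy one (`part_eq_partIn`): a vertex omitted at
its step would be joined by a path to a sink or source in the next part, and the uniserial module on
that path would be both torsion and torsion-free. -/

namespace QuiverTorsion

/-! ### The path algebra of the cyclic quiver -/

section Algebra

/-- The successor of a vertex of the cyclic quiver, as a permutation. -/
def succPerm (n : ℕ) [NeZero n] : Equiv.Perm (CyclicQuiver n) :=
  (Equiv.addRight (1 : Fin n) : Equiv.Perm (Fin n))

instance (n : ℕ) : DecidableEq (CyclicQuiver n) := inferInstanceAs (DecidableEq (Fin n))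

variable {n : ℕ} [NeZero n]

/-- The arrow starting at a vertex. -/
def arrowFrom (v : CyclicQuiver n) : v ⟶ succPerm n v := PLift.up rfl

lemma eq_succ_of_hom {v w : CyclicQuiver n} (f : v ⟶ w) : w = succPerm n v := f.down

lemma isEmpty_hom_iff {v w : CyclicQuiver n} : IsEmpty (v ⟶ w) ↔ w ≠ succPerm n v :=
  ⟨fun h hw => h.elim (PLift.up hw), fun h => ⟨fun f => h (eq_succ_of_hom f)⟩⟩

lemma exists_iterate_add_one_eq (v w : Fin n) : ∃ l : ℕ, (fun x : Fin n => x + 1)^[l] v = w := by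
  have key : ∀ l : ℕ, (fun x : Fin n => x + 1)^[l] v = v + Fin.ofNat n l := by
    intro l
    induction l with
    | zero => exact (add_zero v).symm
    | succ l ih =>
      rw [Function.iterate_succ_apply', ih, add_assoc]
      congr 1
      apply Fin.ext
      simp [Fin.ofNat, Fin.val_add]
  refine ⟨(w - v).val, (key _).trans ?_⟩
  have : Fin.ofNat n (w - v).val = w - v := Fin.ext (Nat.mod_eq_of_lt (w - v).isLt)
  rw [this, add_sub_cancel]

lemma exists_iterate_eq (v w : CyclicQuiver n) : ∃ l : ℕ, (succPerm n)^[l] v = w :=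
  exists_iterate_add_one_eq v w

variable (K : Type u) [Field K]

/-- The path algebra of the cyclic quiver. -/
abbrev CyclicAlgebra (K : Type u) [Field K] (n : ℕ) [NeZero n] : Type u :=
  PathAlgebra K (CyclicQuiver n)

/-- The sum of all arrows. -/
noncomputable def arrowSum (K : Type u) [Field K] (n : ℕ) [NeZero n] : CyclicAlgebra K n :=
  ∑ v : CyclicQuiver n, arrowElt K (arrowFrom v)

variable {K}

lemma mk_eq_of_rel {V : Type} [Quiver.{0} V] [Fintype V] {x y : FreeAlgebra K (PathGen V)}
    (h : PathRel K V x y) : PathAlgebra.mk K V x = PathAlgebra.mk K V y :=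
  RingQuot.mkAlgHom_rel K h

lemma idem_mul_idem_self {V : Type} [Quiver.{0} V] [Fintype V] (v : V) :
    idem K v * idem K v = idem K v := by
  have := mk_eq_of_rel (PathRel.idem (K := K) v)
  rwa [map_mul] at this

lemma idem_mul_idem_of_ne {V : Type} [Quiver.{0} V] [Fintype V] {v w : V} (h : v ≠ w) :
    idem K v * idem K w = 0 := by
  have := mk_eq_of_rel (PathRel.orth (K := K) v w h)
  rwa [map_mul, map_zero] at this

lemma sum_idem {V : Type} [Quiver.{0} V] [Fintype V] : ∑ v : V, idem K v = 1 := by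
  have := mk_eq_of_rel (PathRel.sum (K := K) (V := V))
  rwa [map_sum, map_one] at this

lemma idem_mul_arrowElt_mul_idem {V : Type} [Quiver.{0} V] [Fintype V] {v w : V} (f : v ⟶ w) :
    idem K w * arrowElt K f * idem K v = arrowElt K f := by
  have := mk_eq_of_rel (PathRel.arrow (K := K) f)
  rwa [map_mul, map_mul] at this

lemma idem_mul_arrowElt {V : Type} [Quiver.{0} V] [Fintype V] [DecidableEq V] {v w : V}
    (f : v ⟶ w) (x : V) : idem K x * arrowElt K f = if x = w then arrowElt K f else 0 := by
  rw [← idem_mul_arrowElt_mul_idem, ← mul_assoc, ← mul_assoc]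
  split_ifs with h
  · rw [h, idem_mul_idem_self]
  · rw [idem_mul_idem_of_ne h, zero_mul, zero_mul]

lemma arrowElt_mul_idem {V : Type} [Quiver.{0} V] [Fintype V] [DecidableEq V] {v w : V}
    (f : v ⟶ w) (x : V) : arrowElt K f * idem K x = if x = v then arrowElt K f else 0 := by
  rw [← idem_mul_arrowElt_mul_idem, mul_assoc]
  split_ifs with h
  · rw [h, idem_mul_idem_self]
  · rw [idem_mul_idem_of_ne (Ne.symm h), mul_zero]

lemma arrowSum_mul_idem (v : CyclicQuiver n) :
    arrowSum K n * idem K v = arrowElt K (arrowFrom v) := by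
  simp [arrowSum, Finset.sum_mul, arrowElt_mul_idem]

lemma idem_succ_mul_arrowSum (v : CyclicQuiver n) :
    idem K (succPerm n v) * arrowSum K n = arrowElt K (arrowFrom v) := by
  simp [arrowSum, Finset.mul_sum, idem_mul_arrowElt]

/-- Passing an idempotent across the sum of arrows shifts its vertex by one. This lets a single
element replace the individual arrows. -/
lemma idem_succ_mul_arrowSum_eq (v : CyclicQuiver n) :
    idem K (succPerm n v) * arrowSum K n = arrowSum K n * idem K v := by
  rw [arrowSum_mul_idem, idem_succ_mul_arrowSum]

lemma arrowElt_eq {v w : CyclicQuiver n} (f : v ⟶ w) :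
    arrowElt K f = arrowSum K n * idem K v := by
  obtain rfl := eq_succ_of_hom f
  rw [arrowSum_mul_idem]
  rfl

/-- The path algebra is generated by the trivial paths and the sum of all arrows. -/
@[elab_as_elim]
lemma cyclicAlgebra_induction {p : CyclicAlgebra K n → Prop}
    (scalar : ∀ c : K, p (algebraMap K _ c)) (idem : ∀ v, p (idem K v)) (arrow : p (arrowSum K n))
    (add : ∀ r s, p r → p s → p (r + s)) (mul : ∀ r s, p r → p s → p (r * s))
    (r : CyclicAlgebra K n) : p r := by
  obtain ⟨r, rfl⟩ := RingQuot.mkAlgHom_surjective K (PathRel K (CyclicQuiver n)) r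
  induction r using FreeAlgebra.induction with
  | grade0 c =>
    rw [AlgHom.commutes]
    exact scalar c
  | grade1 g =>
    cases g with
    | vertex v => exact idem v
    | arrow f =>
      change p (arrowElt K f)
      rw [arrowElt_eq]
      exact mul _ _ arrow (idem _)
  | mul r s hr hs => rw [map_mul]; exact mul _ _ hr hs
  | add r s hr hs => rw [map_add]; exact add _ _ hr hs

open Classical in
lemma character_idem {V : Type} [Quiver.{0} V] [Fintype V] (v w : V) :
    character K v (idem K w) = if w = v then 1 else 0 := by
  unfold character idem PathAlgebra.mk
  erw [RingQuot.liftAlgHom_mkAlgHom_apply]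
  simp

lemma character_arrowElt {V : Type} [Quiver.{0} V] [Fintype V] (v : V) {x y : V} (f : x ⟶ y) :
    character K v (arrowElt K f) = 0 := by
  unfold character arrowElt PathAlgebra.mk
  erw [RingQuot.liftAlgHom_mkAlgHom_apply]
  simp

lemma character_arrowSum (v : CyclicQuiver n) : character K v (arrowSum K n) = 0 := by
  simp [arrowSum, character_arrowElt]

/-- One half of the normality of `arrowSum K n`: it commutes with scalars and only shifts
idempotents. Because of this its kernel on a module is a submodule; the mirror statement
`mul_arrowSum_mem` does the same for images. -/
lemma arrowSum_mul_mem (r : CyclicAlgebra K n) : ∃ s, arrowSum K n * r = s * arrowSum K n := by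
  induction r using cyclicAlgebra_induction with
  | scalar c => exact ⟨_, (Algebra.commutes c _).symm⟩
  | idem v => exact ⟨_, (idem_succ_mul_arrowSum_eq v).symm⟩
  | arrow => exact ⟨_, rfl⟩
  | add r s hr hs =>
    obtain ⟨r', hr⟩ := hr
    obtain ⟨s', hs⟩ := hs
    exact ⟨r' + s', by rw [mul_add, hr, hs, add_mul]⟩
  | mul r s hr hs =>
    obtain ⟨r', hr⟩ := hr
    obtain ⟨s', hs⟩ := hs
    exact ⟨r' * s', by rw [← mul_assoc, hr, mul_assoc, hs, mul_assoc]⟩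

lemma mul_arrowSum_mem (r : CyclicAlgebra K n) : ∃ s, r * arrowSum K n = arrowSum K n * s := by
  induction r using cyclicAlgebra_induction with
  | scalar c => exact ⟨_, Algebra.commutes c _⟩
  | idem v =>
    obtain ⟨w, rfl⟩ := (succPerm n).surjective v
    exact ⟨_, idem_succ_mul_arrowSum_eq w⟩
  | arrow => exact ⟨_, rfl⟩
  | add r s hr hs =>
    obtain ⟨r', hr⟩ := hr
    obtain ⟨s', hs⟩ := hs
    exact ⟨r' + s', by rw [mul_add, ← hr, ← hs, add_mul]⟩
  | mul r s hr hs =>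
    obtain ⟨r', hr⟩ := hr
    obtain ⟨s', hs⟩ := hs
    exact ⟨r' * s', by rw [mul_assoc, hs, ← mul_assoc, hr, mul_assoc]⟩

end Algebra

/-! ### Modules over the cyclic path algebra -/

section Modules

variable {K : Type u} [Field K] {n : ℕ} [NeZero n]
variable {X : Type*} [AddCommGroup X] [Module (CyclicAlgebra K n) X]

lemma sum_idem_smul {V : Type} [Quiver.{0} V] [Fintype V] {X : Type*} [AddCommGroup X]
    [Module (PathAlgebra K V) X] (x : X) : ∑ v : V, idem K v • x = x := by
  rw [← Finset.sum_smul, sum_idem, one_smul]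

lemma idem_smul_idem_smul {V : Type} [Quiver.{0} V] [Fintype V] {X : Type*} [AddCommGroup X]
    [Module (PathAlgebra K V) X] (v : V) (x : X) :
    idem K v • idem K v • x = idem K v • x := by
  rw [smul_smul, idem_mul_idem_self]

lemma idem_smul_of_ne {V : Type} [Quiver.{0} V] [Fintype V] {X : Type*} [AddCommGroup X]
    [Module (PathAlgebra K V) X] {v w : V} (h : v ≠ w) {x : X} (hx : idem K w • x = x) :
    idem K v • x = 0 := by
  rw [← hx, smul_smul, idem_mul_idem_of_ne h, zero_smul]

lemma idem_succ_smul_arrowSum_smul (v : CyclicQuiver n) (x : X) :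
    idem K (succPerm n v) • arrowSum K n • x = arrowSum K n • idem K v • x := by
  rw [smul_smul, smul_smul, idem_succ_mul_arrowSum_eq]

lemma idem_smul_pow_smul {v : CyclicQuiver n} {x : X} (hx : idem K v • x = x) (k : ℕ) :
    idem K ((succPerm n)^[k] v) • arrowSum K n ^ k • x = arrowSum K n ^ k • x := by
  induction k with
  | zero => simpa using hx
  | succ k ih =>
    rw [Function.iterate_succ_apply', pow_succ', mul_smul, idem_succ_smul_arrowSum_smul, ih]

/-- A `K`-subspace that is stable under the trivial paths and the sum of all arrows. -/
def stableSubmodule (S : AddSubmonoid X)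
    (scalar : ∀ (c : K), ∀ x ∈ S, algebraMap K (CyclicAlgebra K n) c • x ∈ S)
    (idem : ∀ v : CyclicQuiver n, ∀ x ∈ S, idem K v • x ∈ S) (arrow : ∀ x ∈ S, arrowSum K n • x ∈ S) :
    Submodule (CyclicAlgebra K n) X where
  toAddSubmonoid := S
  smul_mem' r := by
    induction r using cyclicAlgebra_induction with
    | scalar c => exact fun {x} hx => scalar c x hx
    | idem v => exact fun {x} hx => idem v x hx
    | arrow => exact fun {x} hx => arrow x hx
    | add r s hr hs => exact fun {x} hx => by rw [add_smul]; exact S.add_mem (hr hx) (hs hx)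
    | mul r s hr hs => exact fun {x} hx => by rw [mul_smul]; exact hr (hs hx)

/-- The submodule of elements killed by all arrows. -/
def arrowKernel (K : Type u) [Field K] (n : ℕ) [NeZero n] (X : Type*) [AddCommGroup X]
    [Module (CyclicAlgebra K n) X] : Submodule (CyclicAlgebra K n) X where
  carrier := {x | arrowSum K n • x = 0}
  zero_mem' := smul_zero _
  add_mem' {x y} hx hy := by
    simp only [Set.mem_ofPred_eq] at *
    rw [smul_add, hx, hy, add_zero]
  smul_mem' r x hx := by
    obtain ⟨s, hs⟩ := arrowSum_mul_mem r
    simp only [Set.mem_ofPred_eq] at *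
    rw [smul_smul, hs, mul_smul, hx, smul_zero]

lemma mem_arrowKernel {x : X} : x ∈ arrowKernel K n X ↔ arrowSum K n • x = 0 := Iff.rfl

/-- The image of a submodule under the sum of all arrows. -/
def arrowImage (N : Submodule (CyclicAlgebra K n) X) : Submodule (CyclicAlgebra K n) X where
  carrier := {x | ∃ y ∈ N, arrowSum K n • y = x}
  zero_mem' := ⟨0, N.zero_mem, smul_zero _⟩
  add_mem' := by
    rintro _ _ ⟨y, hy, rfl⟩ ⟨z, hz, rfl⟩
    exact ⟨y + z, N.add_mem hy hz, smul_add _ _ _⟩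
  smul_mem' := by
    rintro r _ ⟨y, hy, rfl⟩
    obtain ⟨s, hs⟩ := mul_arrowSum_mem r
    exact ⟨s • y, N.smul_mem _ hy, by rw [smul_smul, smul_smul, hs]⟩

lemma smul_mem_arrowImage {r : CyclicAlgebra K n} (hr : r ∈ arrowIdeal K (CyclicQuiver n))
    {N : Submodule (CyclicAlgebra K n) X} {x : X} (hx : x ∈ N) : r • x ∈ arrowImage N := by
  rw [arrowIdeal, TwoSidedIdeal.mem_asIdeal] at hr
  induction hr using TwoSidedIdeal.span_induction generalizing x with
  | mem r h =>
    obtain ⟨v, w, f, rfl⟩ := h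
    rw [arrowElt_eq, mul_smul]
    exact ⟨_, N.smul_mem _ hx, rfl⟩
  | zero => rw [zero_smul]; exact Submodule.zero_mem _
  | add r s _ _ hr hs => rw [add_smul]; exact Submodule.add_mem _ (hr hx) (hs hx)
  | neg r _ hr => rw [neg_smul]; exact Submodule.neg_mem _ (hr hx)
  | left_absorb r s _ hs => rw [mul_smul]; exact Submodule.smul_mem _ _ (hs hx)
  | right_absorb r s _ hs => rw [mul_smul]; exact hs (N.smul_mem _ hx)

lemma arrowSum_mem_arrowIdeal : arrowSum K n ∈ arrowIdeal K (CyclicQuiver n) :=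
  Submodule.sum_mem _ fun v _ => TwoSidedIdeal.subset_span ⟨_, _, arrowFrom v, rfl⟩

/-- Replaces nilpotency of the ideal by nilpotency of one operator. Every arrow is the sum of arrows
times an idempotent, so the ideal maps N into `arrowImage N`; iterating, its k-th power maps N into
the image of the k-th power of `arrowSum K n`. -/
lemma arrowIdeal_pow_smul_eq_bot_iff (N : ℕ) :
    arrowIdeal K (CyclicQuiver n) ^ N • (⊤ : Submodule (CyclicAlgebra K n) X) = ⊥ ↔
      ∀ x : X, arrowSum K n ^ N • x = 0 := by
  constructor
  · intro h x
    rw [← Submodule.mem_bot (CyclicAlgebra K n), ← h]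
    exact Submodule.smul_mem_smul (Ideal.pow_mem_pow arrowSum_mem_arrowIdeal N) trivial
  · intro h
    have key : ∀ (k : ℕ) (N : Submodule (CyclicAlgebra K n) X),
        ∀ x ∈ arrowIdeal K (CyclicQuiver n) ^ k • N, ∃ y ∈ N, arrowSum K n ^ k • y = x := by
      intro k
      induction k with
      | zero =>
        intro N x hx
        exact ⟨x, Submodule.smul_le_right hx, by simp⟩
      | succ k ih =>
        intro N x hx
        rw [Submodule.pow_succ, Submodule.mul_smul] at hx
        obtain ⟨y, hy, rfl⟩ := ih _ x hx
        have hle : arrowIdeal K (CyclicQuiver n) • N ≤ arrowImage N :=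
          Submodule.smul_le.2 fun r hr y hy => smul_mem_arrowImage hr hy
        obtain ⟨z, hz, rfl⟩ := hle hy
        exact ⟨z, hz, by rw [pow_succ, mul_smul]⟩
    rw [eq_bot_iff]
    intro x hx
    obtain ⟨y, -, rfl⟩ := key N ⊤ x hx
    exact h y

end Modules

/-! ### Semisimple modules, socles and tops -/

section Semisimple

variable {K : Type u} [Field K] {n : ℕ} [NeZero n]

lemma simpleAt_smul_def {V : Type} [Quiver.{0} V] [Fintype V] {v : V} (r : PathAlgebra K V)
    (x : SimpleAt K v) : r • x = (show K from character K v r * (show K from x)) := rfl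

lemma simpleAt_smul_eq_zero {V : Type} [Quiver.{0} V] [Fintype V] {v : V} {r : PathAlgebra K V}
    (h : character K v r = 0) (x : SimpleAt K v) : r • x = 0 := by
  rw [simpleAt_smul_def, h]
  exact zero_mul (show K from x)

instance {V : Type} [Quiver.{0} V] [Fintype V] (v : V) :
    IsSimpleModule (PathAlgebra K V) (SimpleAt K v) := by
  rw [isSimpleModule_iff_toSpanSingleton_surjective]
  refine ⟨inferInstanceAs (Nontrivial K), fun x hx y => ?_⟩
  refine ⟨algebraMap K _ ((show K from y) / (show K from x)), ?_⟩
  rw [LinearMap.toSpanSingleton_apply, simpleAt_smul_def, AlgHom.commutes]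
  exact div_mul_cancel₀ (show K from y) (show (show K from x) ≠ 0 from hx)

variable {X : Type*} [AddCommGroup X] [Module (CyclicAlgebra K n) X]

/-- Every element is a combination of elements of the form `e_v x`, `v ∈ D`. -/
def IsGeneratedAt (D : Set (CyclicQuiver n)) (X : Type*) [AddCommGroup X]
    [Module (CyclicAlgebra K n) X] : Prop :=
  Submodule.span (CyclicAlgebra K n) {x : X | ∃ v ∈ D, idem K v • x = x} = ⊤

/-- The elements killed by all arrows are concentrated at the vertices in `D`. -/
def HasSocleAt (D : Set (CyclicQuiver n)) (X : Type*) [AddCommGroup X]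
    [Module (CyclicAlgebra K n) X] : Prop :=
  ∀ x : X, arrowSum K n • x = 0 → ∀ v, v ∉ D → idem K v • x = 0

/-- Some power of the sum of all arrows acts by zero. -/
def IsArrowNilpotent (K : Type u) [Field K] (n : ℕ) [NeZero n] (X : Type*) [AddCommGroup X]
    [Module (CyclicAlgebra K n) X] : Prop :=
  ∃ N : ℕ, ∀ x : X, arrowSum K n ^ N • x = 0

lemma smul_eq_character_smul {v : CyclicQuiver n} {x : X} (hx : idem K v • x = x)
    (ha : arrowSum K n • x = 0) (r : CyclicAlgebra K n) :
    r • x = algebraMap K (CyclicAlgebra K n) (character K v r) • x := by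
  induction r using cyclicAlgebra_induction with
  | scalar c => rw [AlgHom.commutes]; rfl
  | idem w =>
    rw [character_idem]
    split_ifs with h
    · rw [h, hx, map_one, one_smul]
    · rw [idem_smul_of_ne h hx, map_zero, zero_smul]
  | arrow => rw [ha, character_arrowSum, map_zero, zero_smul]
  | add r s hr hs => rw [add_smul, hr, hs, map_add, map_add, add_smul]
  | mul r s hr hs =>
    rw [mul_smul, hs, smul_smul, ← Algebra.commutes, mul_smul, hr, smul_smul, ← map_mul,
      map_mul (character K v), mul_comm]

/-- Nakayama's lemma for modules on which the arrows act nilpotently. -/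
lemma eq_top_of_sup_arrowImage (hX : IsArrowNilpotent K n X)
    {N : Submodule (CyclicAlgebra K n) X} (h : ∀ x : X, ∃ y ∈ N, ∃ z, x = y + arrowSum K n • z) :
    N = ⊤ := by
  have key : ∀ (k : ℕ) (x : X), ∃ y ∈ N, ∃ z, x = y + arrowSum K n ^ k • z := by
    intro k
    induction k with
    | zero => exact fun x => ⟨0, N.zero_mem, x, by simp⟩
    | succ k ih =>
      intro x
      obtain ⟨y, hy, z, rfl⟩ := ih x
      obtain ⟨y', hy', z', rfl⟩ := h z
      exact ⟨y + arrowSum K n ^ k • y', N.add_mem hy (N.smul_mem _ hy'), z', by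
        rw [smul_add, pow_succ, mul_smul, add_assoc]⟩
  obtain ⟨k, hk⟩ := hX
  rw [eq_top_iff]
  rintro x -
  obtain ⟨y, hy, z, rfl⟩ := key k x
  rwa [hk, add_zero]

lemma isGeneratedAt_of_forall {D : Set (CyclicQuiver n)} (hX : IsArrowNilpotent K n X)
    (h : ∀ x : X, ∀ v, v ∉ D → idem K v • x ∈ arrowImage (⊤ : Submodule (CyclicAlgebra K n) X)) :
    IsGeneratedAt (K := K) D X := by
  refine eq_top_of_sup_arrowImage hX fun x => ?_
  have key : x ∈ Submodule.span (CyclicAlgebra K n) {x : X | ∃ v ∈ D, idem K v • x = x} ⊔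
      arrowImage (⊤ : Submodule (CyclicAlgebra K n) X) := by
    rw [← sum_idem_smul (K := K) (V := CyclicQuiver n) x]
    refine Submodule.sum_mem _ fun v _ => ?_
    by_cases hv : v ∈ D
    · exact Submodule.mem_sup_left (Submodule.subset_span ⟨v, hv, idem_smul_idem_smul v x⟩)
    · exact Submodule.mem_sup_right (h x v hv)
  obtain ⟨y, hy, z, ⟨w, -, rfl⟩, rfl⟩ := Submodule.mem_sup.1 key
  exact ⟨y, hy, w, rfl⟩

/-- The elements whose components outside D are in the image of the arrows form a submodule, and it
contains the generators. -/
lemma IsGeneratedAt.idem_smul_mem {D : Set (CyclicQuiver n)} (h : IsGeneratedAt (K := K) D X)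
    (x : X) {v : CyclicQuiver n} (hv : v ∉ D) :
    idem K v • x ∈ arrowImage (⊤ : Submodule (CyclicAlgebra K n) X) := by
  let S : AddSubmonoid X :=
    { carrier := {x | ∀ v, v ∉ D → idem K v • x ∈ arrowImage (⊤ : Submodule (CyclicAlgebra K n) X)}
      zero_mem' := fun v _ => by rw [smul_zero]; exact Submodule.zero_mem _
      add_mem' := fun hx hy v hv => by
        rw [smul_add]; exact Submodule.add_mem _ (hx v hv) (hy v hv) }
  let N := stableSubmodule S
    (fun c x hx v hv => by
      rw [smul_smul, ← Algebra.commutes, mul_smul]; exact Submodule.smul_mem _ _ (hx v hv))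
    (fun w x hx v hv => by
      by_cases hvw : v = w
      · rw [← hvw, idem_smul_idem_smul]; exact hx v hv
      · rw [idem_smul_of_ne hvw (idem_smul_idem_smul w x)]; exact Submodule.zero_mem _)
    (fun x _ v _ => Submodule.smul_mem _ _ ⟨x, trivial, rfl⟩)
  have hN : Submodule.span (CyclicAlgebra K n) {x : X | ∃ v ∈ D, idem K v • x = x} ≤ N := by
    rw [Submodule.span_le]
    rintro x ⟨w, hw, hx⟩ v hv
    rw [idem_smul_of_ne (by rintro rfl; exact hv hw) hx]
    exact Submodule.zero_mem _
  rw [h] at hN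
  exact hN (Submodule.mem_top (x := x)) v hv

lemma IsSumOfSimples.idem_smul {D : Set (CyclicQuiver n)} (h : IsSumOfSimples (K := K) D X)
    (x : X) {v : CyclicQuiver n} (hv : v ∉ D) : idem K v • x = 0 := by
  obtain ⟨k, f, hf, ⟨e⟩⟩ := h
  apply e.injective
  rw [map_smul, map_zero]
  ext j
  refine simpleAt_smul_eq_zero ?_ _
  rw [character_idem, if_neg (by rintro rfl; exact hv (hf j))]

/-- The Peirce decomposition provides a K-basis of vectors each sitting at one vertex. As the arrows
act by zero, the algebra acts on each basis vector through the character of its vertex. -/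
lemma isSumOfSimples_of_forall [Module K X] [IsScalarTower K (CyclicAlgebra K n) X]
    [FiniteDimensional K X] {D : Set (CyclicQuiver n)} (ha : ∀ x : X, arrowSum K n • x = 0)
    (hD : ∀ x : X, ∀ v, v ∉ D → idem K v • x = 0) : IsSumOfSimples (K := K) D X := by
  classical
  have hspan : ⊤ ≤ Submodule.span K {x : X | ∃ v : CyclicQuiver n, idem K v • x = x} := by
    rintro x -
    rw [← sum_idem_smul (K := K) (V := CyclicQuiver n) x]
    exact Submodule.sum_mem _ fun v _ => Submodule.subset_span ⟨v, idem_smul_idem_smul v x⟩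
  let b₀ := Module.Basis.ofSpan hspan
  have := Module.Finite.finite_basis b₀
  have := Fintype.ofFinite ((linearIndepOn_empty K (id : X → X)).extend (Set.empty_subset
    {x : X | ∃ v : CyclicQuiver n, idem K v • x = x}))
  let b := b₀.reindex (Fintype.equivFin _)
  have hb : ∀ j, ∃ v : CyclicQuiver n, idem K v • b j = b j := fun j =>
    Module.Basis.ofSpan_subset hspan ⟨(Fintype.equivFin _).symm j, by simp [b, b₀]⟩
  choose f hf using hb
  refine ⟨_, f, fun j => ?_, ⟨?_⟩⟩
  · by_contra h
    exact b.ne_zero j ((hf j).symm.trans (hD (b j) _ h))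
  · refine LinearEquiv.symm (M := (j : _) → SimpleAt K (f j))
      { toFun := fun g => b.equivFun.symm g
        invFun := b.equivFun
        left_inv := b.equivFun.right_inv
        right_inv := b.equivFun.left_inv
        map_add' := map_add b.equivFun.symm
        map_smul' := fun r g => ?_ }
    have key : ∀ (c : K) j, (character K (f j) r * c) • b j = r • c • b j := by
      intro c j
      rw [algebra_compatible_smul (CyclicAlgebra K n) c (b j), smul_smul,
        smul_eq_character_smul (hf j) (ha _), map_mul, AlgHom.commutes, algebraMap_smul]
      rfl
    refine (b.equivFun_symm_apply _).trans (Eq.trans ?_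
      (congrArg (fun x => r • x) (b.equivFun_symm_apply _).symm))
    rw [Finset.smul_sum]
    exact Finset.sum_congr rfl fun j _ => key (g j) j

lemma IsSumOfSimples.isSemisimpleModule {D : Set (CyclicQuiver n)}
    (h : IsSumOfSimples (K := K) D X) : IsSemisimpleModule (CyclicAlgebra K n) X := by
  obtain ⟨k, f, -, ⟨e⟩⟩ := h
  exact IsSemisimpleModule.congr e

lemma isSimpleModule_span_singleton {v : CyclicQuiver n} {x : X} (hx : idem K v • x = x)
    (ha : arrowSum K n • x = 0) (h0 : x ≠ 0) :
    IsSimpleModule (CyclicAlgebra K n) (Submodule.span (CyclicAlgebra K n) {x}) := by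
  rw [isSimpleModule_iff_toSpanSingleton_surjective]
  refine ⟨⟨⟨x, Submodule.mem_span_singleton_self x⟩, 0, fun h => h0 (congrArg Subtype.val h)⟩, ?_⟩
  rintro ⟨y, hy⟩ hy0 ⟨z, hz⟩
  obtain ⟨r, rfl⟩ := Submodule.mem_span_singleton.1 hy
  obtain ⟨s, rfl⟩ := Submodule.mem_span_singleton.1 hz
  have hc : character K v r ≠ 0 := fun h => hy0 (Subtype.ext (by
    change r • x = 0
    rw [smul_eq_character_smul hx ha, h, map_zero, zero_smul]))
  refine ⟨algebraMap K _ (character K v s / character K v r), Subtype.ext ?_⟩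
  change algebraMap K (CyclicAlgebra K n) _ • r • x = s • x
  rw [smul_eq_character_smul hx ha r, smul_eq_character_smul hx ha s, smul_smul, ← map_mul,
    div_mul_cancel₀ _ hc]

/-- For a simple submodule N the image of N under the arrows is 0 or N, and the second contradicts
nilpotency. Conversely, each nonzero component of an element of the kernel spans a simple module. -/
lemma socle_eq_arrowKernel (hX : IsArrowNilpotent K n X) :
    socle (CyclicAlgebra K n) X = arrowKernel K n X := by
  apply le_antisymm
  · refine sSup_le fun N hN => ?_
    have hat := isSimpleModule_iff_isAtom.1 (show IsSimpleModule _ N from hN)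
    have hle : arrowImage N ≤ N := by
      rintro _ ⟨y, hy, rfl⟩
      exact N.smul_mem _ hy
    rcases hat.le_iff.1 hle with h | h
    · intro x hx
      exact (Submodule.mem_bot (CyclicAlgebra K n)).1 (h ▸ ⟨x, hx, rfl⟩)
    · refine absurd ?_ hat.1
      have key : ∀ (k : ℕ), ∀ x ∈ N, ∃ y ∈ N, arrowSum K n ^ k • y = x := by
        intro k
        induction k with
        | zero => exact fun x hx => ⟨x, hx, by simp⟩
        | succ k ih =>
          intro x hx
          obtain ⟨y, hy, rfl⟩ := ih x hx
          rw [← h] at hy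
          obtain ⟨z, hz, rfl⟩ := hy
          exact ⟨z, hz, by rw [pow_succ, mul_smul]⟩
      obtain ⟨k, hk⟩ := hX
      rw [eq_bot_iff]
      intro x hx
      obtain ⟨y, -, rfl⟩ := key k x hx
      exact hk y
  · intro x hx
    rw [← sum_idem_smul (K := K) (V := CyclicQuiver n) x]
    refine Submodule.sum_mem _ fun v _ => ?_
    by_cases h0 : idem K v • x = 0
    · rw [h0]; exact Submodule.zero_mem _
    · have := isSimpleModule_span_singleton (idem_smul_idem_smul v x)
        ((arrowKernel K n X).smul_mem (idem K v) hx) h0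
      exact Submodule.mem_sSup_of_mem this (Submodule.mem_span_singleton_self _)

instance finiteDimensional_quotient [Module K X] [IsScalarTower K (CyclicAlgebra K n) X]
    [FiniteDimensional K X] (N : Submodule (CyclicAlgebra K n) X) : FiniteDimensional K (X ⧸ N) :=
  Module.Finite.of_surjective (N.mkQ.restrictScalars K) (Submodule.mkQ_surjective _)

lemma arrowSum_smul_quotient_arrowImage
    (x : X ⧸ arrowImage (⊤ : Submodule (CyclicAlgebra K n) X)) : arrowSum K n • x = 0 := by
  obtain ⟨x, rfl⟩ := Submodule.mkQ_surjective _ x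
  exact (Submodule.Quotient.mk_eq_zero _).2 ⟨x, trivial, rfl⟩

lemma isSumOfSimples_quotient_arrowImage_iff [Module K X] [IsScalarTower K (CyclicAlgebra K n) X]
    [FiniteDimensional K X] (hX : IsArrowNilpotent K n X) (D : Set (CyclicQuiver n)) :
    IsSumOfSimples (K := K) D (X ⧸ arrowImage (⊤ : Submodule (CyclicAlgebra K n) X)) ↔
      IsGeneratedAt (K := K) D X := by
  constructor
  · refine fun h => isGeneratedAt_of_forall hX fun x v hv => ?_
    exact (Submodule.Quotient.mk_eq_zero _).1 (h.idem_smul (Submodule.Quotient.mk x) hv)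
  · intro h
    refine isSumOfSimples_of_forall arrowSum_smul_quotient_arrowImage fun x v hv => ?_
    obtain ⟨x, rfl⟩ := Submodule.mkQ_surjective _ x
    exact (Submodule.Quotient.mk_eq_zero _).2 (h.idem_smul_mem x hv)

/-- The quotient by the image of the arrows is semisimple, so the radical lies in that image. A
maximal submodule not containing the image would be everything by Nakayama. -/
lemma jacobson_eq_arrowImage [Module K X] [IsScalarTower K (CyclicAlgebra K n) X]
    [FiniteDimensional K X] (hX : IsArrowNilpotent K n X) :
    Module.jacobson (CyclicAlgebra K n) X = arrowImage ⊤ := by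
  apply le_antisymm
  · apply Module.jacobson_le_of_eq_bot
    have h : IsSumOfSimples (K := K) (Set.univ : Set (CyclicQuiver n))
        (X ⧸ arrowImage (⊤ : Submodule (CyclicAlgebra K n) X)) :=
      isSumOfSimples_of_forall arrowSum_smul_quotient_arrowImage
        (fun x v hv => absurd trivial hv)
    have := h.isSemisimpleModule
    exact IsSemisimpleModule.jacobson_eq_bot _ _
  · refine le_sInf fun m hm => ?_
    by_contra hle
    have htop : m ⊔ arrowImage ⊤ = ⊤ := hm.2 _ (left_lt_sup.2 hle)
    refine hm.1 (eq_top_of_sup_arrowImage hX fun x => ?_)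
    obtain ⟨y, hy, z, ⟨w, -, rfl⟩, rfl⟩ := Submodule.mem_sup.1 (htop ▸ Submodule.mem_top (x := x))
    exact ⟨y, hy, w, rfl⟩

lemma isSumOfSimples_topQuotient_iff [Module K X] [IsScalarTower K (CyclicAlgebra K n) X]
    [FiniteDimensional K X] (hX : IsArrowNilpotent K n X) (D : Set (CyclicQuiver n)) :
    IsSumOfSimples (K := K) D (TopQuotient (CyclicAlgebra K n) X) ↔
      IsGeneratedAt (K := K) D X := by
  rw [← isSumOfSimples_quotient_arrowImage_iff hX, ← jacobson_eq_arrowImage hX]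

lemma isSumOfSimples_socle_iff [Module K X] [IsScalarTower K (CyclicAlgebra K n) X]
    [FiniteDimensional K X] (hX : IsArrowNilpotent K n X) (D : Set (CyclicQuiver n)) :
    IsSumOfSimples (K := K) D (socle (CyclicAlgebra K n) X) ↔ HasSocleAt (K := K) D X := by
  rw [socle_eq_arrowKernel hX]
  constructor
  · intro h x hx v hv
    exact congrArg Subtype.val (h.idem_smul ⟨x, hx⟩ hv)
  · intro h
    have : FiniteDimensional K (arrowKernel K n X) :=
      Module.Finite.of_injective ((arrowKernel K n X).subtype.restrictScalars K)
        Subtype.val_injective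
    exact isSumOfSimples_of_forall (fun x => Subtype.ext x.2)
      (fun x v hv => Subtype.ext (h x.1 x.2 v hv))

end Semisimple

/-! ### Ordinary modules: closure properties, and rays and corays in terms of the arrow operator -/

section Categorical

variable {K : Type u} [Field K] {n : ℕ} [NeZero n] {M N : ModuleCat.{u} (CyclicAlgebra K n)}

open scoped ModuleCat in
lemma isOrdinary_iff : IsOrdinary K (CyclicQuiver n) M ↔
    FiniteDimensional K M ∧ IsArrowNilpotent K n M :=
  and_congr Iff.rfl (exists_congr fun N => arrowIdeal_pow_smul_eq_bot_iff N)

lemma IsOrdinary.isArrowNilpotent (h : IsOrdinary K (CyclicQuiver n) M) :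
    IsArrowNilpotent K n M := (isOrdinary_iff.1 h).2

open scoped ModuleCat in
lemma IsOrdinary.isNoetherian (h : IsOrdinary K (CyclicQuiver n) M) :
    IsNoetherian (CyclicAlgebra K n) M := by
  have := h.1
  exact isNoetherian_of_tower K inferInstance

open scoped ModuleCat in
lemma IsOrdinary.of_injective (h : IsOrdinary K (CyclicQuiver n) M)
    (f : N →ₗ[CyclicAlgebra K n] M) (hf : Function.Injective f) :
    IsOrdinary K (CyclicQuiver n) N := by
  have := h.1
  refine isOrdinary_iff.2 ⟨Module.Finite.of_injective (f.restrictScalars K) hf, ?_⟩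
  obtain ⟨k, hk⟩ := h.isArrowNilpotent
  exact ⟨k, fun x => hf (by rw [map_smul, hk, map_zero])⟩

open scoped ModuleCat in
lemma IsOrdinary.of_surjective (h : IsOrdinary K (CyclicQuiver n) M)
    (f : M →ₗ[CyclicAlgebra K n] N) (hf : Function.Surjective f) :
    IsOrdinary K (CyclicQuiver n) N := by
  have := h.1
  refine isOrdinary_iff.2 ⟨Module.Finite.of_surjective (f.restrictScalars K) hf, ?_⟩
  obtain ⟨k, hk⟩ := h.isArrowNilpotent
  refine ⟨k, fun x => ?_⟩
  obtain ⟨x, rfl⟩ := hf x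
  rw [← map_smul, hk, map_zero]

open scoped ModuleCat in
lemma isOrdinary_of_exact {L : ModuleCat.{u} (CyclicAlgebra K n)}
    {f : L →ₗ[CyclicAlgebra K n] M} {g : M →ₗ[CyclicAlgebra K n] N}
    (hL : IsOrdinary K (CyclicQuiver n) L) (hN : IsOrdinary K (CyclicQuiver n) N)
    (hfg : Function.Exact f g) (hg : Function.Surjective g) :
    IsOrdinary K (CyclicQuiver n) M := by
  have := hL.1
  have := hN.1
  refine isOrdinary_iff.2 ⟨?_, ?_⟩
  · exact Module.Finite.of_exact (f := f.restrictScalars K) (g := g.restrictScalars K) hfg hg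
  · obtain ⟨k, hk⟩ := hL.isArrowNilpotent
    obtain ⟨l, hl⟩ := hN.isArrowNilpotent
    refine ⟨k + l, fun x => ?_⟩
    obtain ⟨y, hy⟩ := (hfg (arrowSum K n ^ l • x)).1 (by rw [map_smul, hl])
    rw [pow_add, mul_smul, ← hy, ← map_smul, hk, map_zero]

open scoped ModuleCat in
lemma isOrdinary_of_subsingleton [Subsingleton M] : IsOrdinary K (CyclicQuiver n) M :=
  isOrdinary_iff.2 ⟨inferInstance, 0, fun _ => Subsingleton.elim _ _⟩

open scoped ModuleCat in
lemma coray_iff {R D : Set (CyclicQuiver n)} : Coray R D M ↔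
    IsOrdinary K (CyclicQuiver n) M ∧ IsSupportedOn R M ∧ IsGeneratedAt (K := K) D M := by
  refine and_congr_right fun h => and_congr_right fun _ => ?_
  have := h.1
  exact isSumOfSimples_topQuotient_iff h.isArrowNilpotent D

open scoped ModuleCat in
lemma ray_iff {R D : Set (CyclicQuiver n)} : Ray R D M ↔
    IsOrdinary K (CyclicQuiver n) M ∧ IsSupportedOn R M ∧ HasSocleAt (K := K) D M := by
  refine and_congr_right fun h => and_congr_right fun _ => ?_
  have := h.1
  exact isSumOfSimples_socle_iff h.isArrowNilpotent D

lemma IsSupportedOn.of_injective {R : Set (CyclicQuiver n)} (h : IsSupportedOn R M)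
    (f : N →ₗ[CyclicAlgebra K n] M) (hf : Function.Injective f) : IsSupportedOn R N :=
  fun v hv x => hf (by rw [map_smul, h v hv, map_zero])

lemma IsSupportedOn.of_surjective {R : Set (CyclicQuiver n)} (h : IsSupportedOn R M)
    (f : M →ₗ[CyclicAlgebra K n] N) (hf : Function.Surjective f) : IsSupportedOn R N := by
  intro v hv x
  obtain ⟨x, rfl⟩ := hf x
  rw [← map_smul, h v hv, map_zero]

lemma HasSocleAt.of_injective {D : Set (CyclicQuiver n)} {X Y : Type*} [AddCommGroup X]
    [AddCommGroup Y] [Module (CyclicAlgebra K n) X] [Module (CyclicAlgebra K n) Y]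
    (h : HasSocleAt (K := K) D X) (f : Y →ₗ[CyclicAlgebra K n] X) (hf : Function.Injective f) :
    HasSocleAt (K := K) D Y :=
  fun x hx v hv => hf (by rw [map_smul, map_zero, h _ (by rw [← map_smul, hx, map_zero]) v hv])

/-- A map from a module generated at `D` is zero if it kills the elements at `D`. -/
lemma IsGeneratedAt.eq_zero {D : Set (CyclicQuiver n)} {X Y : Type*} [AddCommGroup X]
    [AddCommGroup Y] [Module (CyclicAlgebra K n) X] [Module (CyclicAlgebra K n) Y]
    (h : IsGeneratedAt (K := K) D X) (f : X →ₗ[CyclicAlgebra K n] Y)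
    (hf : ∀ v ∈ D, ∀ x : X, idem K v • x = x → f x = 0) : f = 0 := by
  rw [← LinearMap.ker_eq_top, eq_top_iff, ← h, Submodule.span_le]
  rintro x ⟨v, hv, hx⟩
  exact hf v hv x hx

end Categorical

/-! ### Uniserial modules -/

section Chain

variable {K : Type u} [Field K] {n : ℕ} [NeZero n]
variable {X Y : Type*} [AddCommGroup X] [Module (CyclicAlgebra K n) X]
  [AddCommGroup Y] [Module (CyclicAlgebra K n) Y]

-- After `idem K u` every element acts as a polynomial in the sum of arrows: an idempotent merely
-- selects the monomials whose degree leads from u to its vertex. A module generated by one element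
-- at u is thus cyclic over K[X].
open Polynomial in
lemma exists_aeval_mul_idem (r : CyclicAlgebra K n) (u : CyclicQuiver n) :
    ∃ p : K[X], r * idem K u = aeval (arrowSum K n) p * idem K u := by
  -- The polynomial factor q is carried along so that a product can be absorbed one factor at a
  -- time.
  have key : ∀ q : K[X], ∃ p : K[X],
      r * (aeval (arrowSum K n) q * idem K u) = aeval (arrowSum K n) p * idem K u := by
    induction r using cyclicAlgebra_induction with
    | scalar c => exact fun q => ⟨C c * q, by rw [map_mul, aeval_C, mul_assoc]⟩
    | idem v =>
      intro q
      induction q using Polynomial.induction_on' with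
      | add p q hp hq =>
        obtain ⟨p', hp⟩ := hp
        obtain ⟨q', hq⟩ := hq
        exact ⟨p' + q', by rw [map_add, add_mul, mul_add, hp, hq, map_add, add_mul]⟩
      | monomial i c =>
        have h : ∀ i : ℕ, idem K ((succPerm n)^[i] u) * (arrowSum K n ^ i * idem K u) =
            arrowSum K n ^ i * idem K u := fun i => by
          have := idem_smul_pow_smul (K := K) (X := CyclicAlgebra K n) (v := u) (x := idem K u)
            (idem_mul_idem_self u) i
          simpa only [smul_eq_mul] using this
        rw [aeval_monomial, mul_assoc, ← mul_assoc (idem K v), ← Algebra.commutes, mul_assoc]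
        by_cases hv : v = (succPerm n)^[i] u
        · exact ⟨monomial i c, by rw [hv, h, aeval_monomial, mul_assoc]⟩
        · refine ⟨0, ?_⟩
          rw [← h, ← mul_assoc (idem K v), idem_mul_idem_of_ne hv, zero_mul, mul_zero, map_zero,
            zero_mul]
    | arrow => exact fun q => ⟨X * q, by rw [map_mul, aeval_X, mul_assoc]⟩
    | add r s hr hs =>
      intro q
      obtain ⟨r', hr⟩ := hr q
      obtain ⟨s', hs⟩ := hs q
      exact ⟨r' + s', by rw [add_mul, hr, hs, map_add, add_mul]⟩
    | mul r s hr hs =>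
      intro q
      obtain ⟨s', hs⟩ := hs q
      obtain ⟨r', hr⟩ := hr s'
      exact ⟨r', by rw [mul_assoc, hs, hr]⟩
  obtain ⟨p, hp⟩ := key 1
  exact ⟨p, by rw [← hp, map_one, one_mul]⟩

open Polynomial in
lemma exists_aeval_smul (r : CyclicAlgebra K n) (u : CyclicQuiver n) :
    ∃ p : K[X], r * idem K u = aeval (arrowSum K n) p * idem K u ∧
      ∀ x : X, idem K u • x = x → r • x = aeval (arrowSum K n) p • x := by
  obtain ⟨p, hp⟩ := exists_aeval_mul_idem r u
  refine ⟨p, hp, fun x hx => ?_⟩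
  rw [← hx, smul_smul, smul_smul, hp]

lemma algebraMap_smul_eq_zero {A : Type*} [Ring A] [Algebra K A] [Module A X] {c : K} {x : X}
    (h : algebraMap K A c • x = 0) (hx : x ≠ 0) : c = 0 := by
  by_contra hc
  apply hx
  rw [← one_smul A x, ← map_one (algebraMap K A), ← inv_mul_cancel₀ hc, map_mul, mul_smul, h,
    smul_zero]

/-- `X` is uniserial with top at `u` and of length `l + 1`, and `y` is a generator at `u`. -/
structure IsChain (K : Type u) [Field K] {n : ℕ} [NeZero n] {X : Type*} [AddCommGroup X]
    [Module (CyclicAlgebra K n) X] (u : CyclicQuiver n) (l : ℕ) (y : X) : Prop where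
  idem_smul : idem K u • y = y
  ne_zero : arrowSum K n ^ l • y ≠ 0
  pow_smul : arrowSum K n ^ (l + 1) • y = 0
  span_eq_top : Submodule.span (CyclicAlgebra K n) {y} = ⊤

lemma pow_smul_eq_zero_of_le {x : X} {k l : ℕ} (h : k ≤ l) (hx : arrowSum K n ^ k • x = 0) :
    arrowSum K n ^ l • x = 0 := by
  rw [← Nat.sub_add_cancel h, pow_add, mul_smul, hx, smul_zero]

lemma IsArrowNilpotent.exists_pow_smul (h : IsArrowNilpotent K n X) {x : X} (hx : x ≠ 0) :
    ∃ l, arrowSum K n ^ l • x ≠ 0 ∧ arrowSum K n ^ (l + 1) • x = 0 := by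
  classical
  obtain ⟨N, hN⟩ := h
  have hex : ∃ k, arrowSum K n ^ k • x = 0 := ⟨N, hN x⟩
  have h0 : Nat.find hex ≠ 0 := fun h => hx (by simpa [h] using Nat.find_spec hex)
  obtain ⟨l, hl⟩ := Nat.exists_eq_succ_of_ne_zero h0
  exact ⟨l, Nat.find_min hex (by omega), by rw [← Nat.succ_eq_add_one, ← hl]; exact Nat.find_spec hex⟩

namespace IsChain

variable {u : CyclicQuiver n} {l : ℕ} {y : X}

lemma pow_smul_ne_zero (h : IsChain K u l y) {i : ℕ} (hi : i ≤ l) : arrowSum K n ^ i • y ≠ 0 :=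
  fun h0 => h.ne_zero (pow_smul_eq_zero_of_le hi h0)

lemma pow_smul_eq_zero (h : IsChain K u l y) {i : ℕ} (hi : l < i) : arrowSum K n ^ i • y = 0 :=
  pow_smul_eq_zero_of_le hi h.pow_smul

open Polynomial in
lemma exists_aeval (h : IsChain K u l y) (x : X) :
    ∃ p : K[X], x = aeval (arrowSum K n) p • y := by
  have hx : x ∈ Submodule.span (CyclicAlgebra K n) {y} := h.span_eq_top ▸ Submodule.mem_top
  obtain ⟨r, rfl⟩ := Submodule.mem_span_singleton.1 hx
  obtain ⟨p, -, hp⟩ := exists_aeval_smul (X := X) r u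
  exact ⟨p, hp y h.idem_smul⟩

/-- The annihilator of y in K[X] is generated by X^(l+1). If X^k divides p with k ≤ l, multiplying
by X^(l-k) isolates the coefficient of X^k in front of the nonzero socle element, so that
coefficient vanishes. -/
lemma X_pow_dvd (h : IsChain K u l y) {p : Polynomial K} (hp : Polynomial.aeval (arrowSum K n) p • y = 0) :
    Polynomial.X ^ (l + 1) ∣ p := by
  have key : ∀ k ≤ l + 1, Polynomial.X ^ k ∣ p := by
    intro k
    induction k with
    | zero => exact fun _ => by rw [pow_zero]; exact one_dvd _
    | succ k ih =>
      intro hk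
      obtain ⟨q, rfl⟩ := ih (by omega)
      have hq : Polynomial.X ^ (l - k) * (Polynomial.X ^ k * q) = Polynomial.C (q.coeff 0) * Polynomial.X ^ l + q.divX * Polynomial.X ^ (l + 1) := by
        conv_lhs => rw [← q.divX_mul_X_add]
        obtain ⟨j, rfl⟩ := Nat.exists_eq_add_of_le (Nat.le_of_succ_le_succ hk)
        rw [Nat.add_sub_cancel_left]
        ring
      have h2 : Polynomial.aeval (arrowSum K n) (Polynomial.X ^ (l - k) * (Polynomial.X ^ k * q)) • y = 0 := by
        rw [map_mul, mul_smul, hp, smul_zero]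
      rw [hq, map_add, map_mul, map_mul, map_pow, map_pow, Polynomial.aeval_X, Polynomial.aeval_C, add_smul, mul_smul,
        mul_smul, h.pow_smul, smul_zero, add_zero] at h2
      have h3 := algebraMap_smul_eq_zero h2 h.ne_zero
      refine ⟨q.divX, ?_⟩
      conv_lhs => rw [← q.divX_mul_X_add, h3, Polynomial.C_0, add_zero]
      ring
  exact key _ le_rfl

@[elab_as_elim]
lemma induction (h : IsChain K u l y) {q : X → Prop}
    (add : ∀ x z, q x → q z → q (x + z))
    (smul : ∀ (c : K) (i : ℕ), i ≤ l →
      q (algebraMap K (CyclicAlgebra K n) c • arrowSum K n ^ i • y)) (x : X) : q x := by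
  obtain ⟨p, rfl⟩ := h.exists_aeval x
  induction p using Polynomial.induction_on' with
  | add p p' hp hp' => rw [map_add, add_smul]; exact add _ _ hp hp'
  | monomial i c =>
    rw [Polynomial.aeval_monomial, mul_smul]
    by_cases hi : i ≤ l
    · exact smul c i hi
    · rw [h.pow_smul_eq_zero (by omega), smul_zero]
      simpa using smul 0 0 (Nat.zero_le _)

/-- The universal property of the uniserial module: it is the projective at u modulo paths of length
l+1. All homomorphisms that contradict a torsion pair below are built from it. -/
lemma exists_hom (h : IsChain K u l y) {x : Y} (hx : idem K u • x = x)
    (hl : arrowSum K n ^ (l + 1) • x = 0) : ∃ f : X →ₗ[CyclicAlgebra K n] Y, f y = x := by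
  have hsurj : Function.Surjective (LinearMap.toSpanSingleton (CyclicAlgebra K n) X y) := by
    rw [← LinearMap.range_eq_top, LinearMap.range_toSpanSingleton, h.span_eq_top]
  have hker : LinearMap.ker (LinearMap.toSpanSingleton (CyclicAlgebra K n) X y) ≤
      LinearMap.ker (LinearMap.toSpanSingleton (CyclicAlgebra K n) Y x) := by
    intro r hr
    rw [LinearMap.mem_ker, LinearMap.toSpanSingleton_apply] at hr ⊢
    obtain ⟨p, hp⟩ := exists_aeval_mul_idem r u
    rw [← h.idem_smul, smul_smul, hp, mul_smul, h.idem_smul] at hr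
    obtain ⟨q, rfl⟩ := h.X_pow_dvd hr
    rw [← hx, smul_smul, hp, mul_smul, hx, mul_comm, map_mul, map_pow, Polynomial.aeval_X,
      mul_smul, hl, smul_zero]
  refine ⟨(Submodule.liftQ _ _ hker).comp
    (LinearMap.quotKerEquivOfSurjective _ hsurj).symm.toLinearMap, ?_⟩
  have hy : (LinearMap.quotKerEquivOfSurjective _ hsurj).symm y = Submodule.Quotient.mk 1 := by
    rw [LinearEquiv.symm_apply_eq]
    simp
  rw [LinearMap.comp_apply, LinearEquiv.coe_coe, hy, Submodule.liftQ_apply,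
    LinearMap.toSpanSingleton_apply, one_smul]

lemma hom_ext (h : IsChain K u l y) {f g : X →ₗ[CyclicAlgebra K n] Y} (hfg : f y = g y) :
    f = g := by
  have : Submodule.span (CyclicAlgebra K n) {y} ≤ LinearMap.eqLocus f g :=
    Submodule.span_le.2 (by simpa using hfg)
  rw [h.span_eq_top, top_le_iff] at this
  exact LinearMap.eqLocus_eq_top.1 this

lemma nonempty_linearEquiv (h : IsChain K u l y) {z : Y} (h' : IsChain K u l z) :
    Nonempty (X ≃ₗ[CyclicAlgebra K n] Y) := by
  obtain ⟨f, hf⟩ := h.exists_hom h'.idem_smul h'.pow_smul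
  obtain ⟨g, hg⟩ := h'.exists_hom h.idem_smul h.pow_smul
  exact ⟨LinearEquiv.ofLinearMap f g
    (h'.hom_ext (by rw [LinearMap.comp_apply, hg, hf, LinearMap.id_apply]))
    (h.hom_ext (by rw [LinearMap.comp_apply, hf, hg, LinearMap.id_apply]))⟩

lemma isGeneratedAt (h : IsChain K u l y) : IsGeneratedAt (K := K) {u} X := by
  rw [IsGeneratedAt, eq_top_iff, ← h.span_eq_top]
  exact Submodule.span_mono (by rintro _ rfl; exact ⟨u, rfl, h.idem_smul⟩)

lemma pow_smul_eq_zero' (h : IsChain K u l y) (x : X) : arrowSum K n ^ (l + 1) • x = 0 := by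
  induction x using h.induction with
  | add x z hx hz => rw [smul_add, hx, hz, add_zero]
  | smul c i hi =>
    rw [smul_smul, ← Algebra.commutes, mul_smul, smul_smul (arrowSum K n ^ (l + 1)), ← pow_add,
      h.pow_smul_eq_zero (by omega), smul_zero]

lemma isArrowNilpotent (h : IsChain K u l y) : IsArrowNilpotent K n X :=
  ⟨l + 1, h.pow_smul_eq_zero'⟩

lemma length_le_of_injective (h : IsChain K u l y) {v : CyclicQuiver n} {k : ℕ} {z : Y}
    (h' : IsChain K v k z) (f : X →ₗ[CyclicAlgebra K n] Y) (hf : Function.Injective f) :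
    l ≤ k := by
  by_contra! hlt
  exact h.ne_zero (hf (by
    rw [map_smul, map_zero, pow_smul_eq_zero_of_le hlt (h'.pow_smul_eq_zero' _)]))

/-- The socle is a line: if X * p annihilates y, then X^l divides p, and only the coefficient of X^l
survives. -/
lemma exists_eq_smul_of_arrowSum_smul (h : IsChain K u l y) {x : X} (hx : arrowSum K n • x = 0) :
    ∃ c : K, x = algebraMap K (CyclicAlgebra K n) c • arrowSum K n ^ l • y := by
  obtain ⟨p, rfl⟩ := h.exists_aeval x
  have h1 : Polynomial.aeval (arrowSum K n) (Polynomial.X * p) • y = 0 := by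
    rwa [map_mul, Polynomial.aeval_X, mul_smul]
  have h2 := h.X_pow_dvd h1
  rw [pow_succ', mul_dvd_mul_iff_left Polynomial.X_ne_zero] at h2
  obtain ⟨q, rfl⟩ := h2
  refine ⟨q.coeff 0, ?_⟩
  conv_lhs => rw [← q.divX_mul_X_add]
  rw [mul_comm, add_mul, mul_assoc, ← pow_succ', map_add, map_mul, map_mul, map_pow, map_pow,
    Polynomial.aeval_X, Polynomial.aeval_C, add_smul, mul_smul, mul_smul, h.pow_smul, smul_zero,
    zero_add]

lemma hasSocleAt (h : IsChain K u l y) : HasSocleAt (K := K) {(succPerm n)^[l] u} X := by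
  intro x hx v hv
  obtain ⟨c, rfl⟩ := h.exists_eq_smul_of_arrowSum_smul hx
  rw [smul_smul, ← Algebra.commutes, mul_smul,
    idem_smul_of_ne hv (idem_smul_pow_smul h.idem_smul l), smul_zero]

lemma finiteDimensional [Module K X] [IsScalarTower K (CyclicAlgebra K n) X]
    (h : IsChain K u l y) : FiniteDimensional K X := by
  classical
  refine ⟨(Finset.range (l + 1)).image (fun i => arrowSum K n ^ i • y), ?_⟩
  rw [eq_top_iff]
  rintro x -
  induction x using h.induction with
  | add x z hx hz => exact Submodule.add_mem _ hx hz
  | smul c i hi =>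
    rw [algebraMap_smul]
    refine Submodule.smul_mem _ _ (Submodule.subset_span ?_)
    exact Finset.mem_coe.2 (Finset.mem_image.2 ⟨i, Finset.mem_range.2 (by omega), rfl⟩)

lemma exists_arrowImage (h : IsChain K u l y) (x : X) :
    ∃ (c : K) (z : X), x = algebraMap K (CyclicAlgebra K n) c • y + arrowSum K n • z := by
  induction x using h.induction with
  | add x z hx hz =>
    obtain ⟨c, x', rfl⟩ := hx
    obtain ⟨d, z', rfl⟩ := hz
    exact ⟨c + d, x' + z', by rw [map_add, add_smul, smul_add]; abel⟩
  | smul c i hi =>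
    cases i with
    | zero => exact ⟨c, 0, by simp⟩
    | succ i =>
      refine ⟨0, algebraMap K (CyclicAlgebra K n) c • arrowSum K n ^ i • y, ?_⟩
      rw [map_zero, zero_smul, zero_add, pow_succ', mul_smul, smul_smul, Algebra.commutes,
        mul_smul]

end IsChain

lemma isChain_span_singleton (hX : IsArrowNilpotent K n X) {u : CyclicQuiver n} {x : X}
    (hx : idem K u • x = x) (h0 : x ≠ 0) :
    ∃ l, IsChain K u l
      (⟨x, Submodule.mem_span_singleton_self x⟩ : Submodule.span (CyclicAlgebra K n) {x}) := by
  obtain ⟨l, h1, h2⟩ := hX.exists_pow_smul h0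
  refine ⟨l, Subtype.ext hx, fun h => h1 (congrArg Subtype.val h), Subtype.ext h2, ?_⟩
  rw [eq_top_iff]
  rintro ⟨z, hz⟩ -
  obtain ⟨r, rfl⟩ := Submodule.mem_span_singleton.1 hz
  exact Submodule.mem_span_singleton.2 ⟨r, rfl⟩

/-- A nilpotent module with one-dimensional socle is uniserial. -/
lemma exists_isChain_of_arrowKernel (hX : IsArrowNilpotent K n X) {v : CyclicQuiver n} {s : X}
    (hs : idem K v • s = s) (h0 : s ≠ 0)
    (hker : ∀ x : X, arrowSum K n • x = 0 → ∃ c : K, x = algebraMap K (CyclicAlgebra K n) c • s) :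
    ∃ u l, ∃ y : X, IsChain K u l y ∧ (succPerm n)^[l] u = v := by
  classical
  have hN : Nat.find hX ≠ 0 := fun h => h0 (by simpa [h] using Nat.find_spec hX s)
  obtain ⟨l, hl⟩ := Nat.exists_eq_succ_of_ne_zero hN
  have hzero : ∀ x : X, arrowSum K n ^ (l + 1) • x = 0 := by
    have := Nat.find_spec hX
    rwa [hl] at this
  have hne : ¬ ∀ x : X, arrowSum K n ^ l • x = 0 := Nat.find_min hX (by omega)
  push Not at hne
  obtain ⟨x, hx⟩ := hne
  obtain ⟨u, hu⟩ : ∃ u : CyclicQuiver n, arrowSum K n ^ l • idem K u • x ≠ 0 := by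
    by_contra! h
    apply hx
    rw [← sum_idem_smul (K := K) (V := CyclicQuiver n) x, Finset.smul_sum]
    exact Finset.sum_eq_zero fun u _ => h u
  obtain ⟨c, hc⟩ := hker (arrowSum K n ^ l • idem K u • x)
    (by rw [smul_smul, ← pow_succ', hzero])
  have hc0 : c ≠ 0 := by
    rintro rfl
    exact hu (by rw [hc, map_zero, zero_smul])
  refine ⟨u, l, idem K u • x, ⟨idem_smul_idem_smul u x, hu, hzero _, ?_⟩, ?_⟩
  · have key : ∀ k ≤ l + 1, ∀ z : X, arrowSum K n ^ k • z = 0 →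
        z ∈ Submodule.span (CyclicAlgebra K n) {idem K u • x} := by
      intro k
      induction k with
      | zero =>
        intro _ z hz
        rw [pow_zero, one_smul] at hz
        rw [hz]
        exact Submodule.zero_mem _
      | succ k ih =>
        intro hk z hz
        obtain ⟨d, hd⟩ := hker (arrowSum K n ^ k • z) (by rw [smul_smul, ← pow_succ', hz])
        let w := algebraMap K (CyclicAlgebra K n) (d / c) • arrowSum K n ^ (l - k) • idem K u • x
        have hw : w ∈ Submodule.span (CyclicAlgebra K n) {idem K u • x} :=
          Submodule.smul_mem _ _ (Submodule.smul_mem _ _ (Submodule.mem_span_singleton_self _))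
        have hzw : arrowSum K n ^ k • (z - w) = 0 := by
          rw [smul_sub, hd, smul_smul (arrowSum K n ^ k), ← Algebra.commutes, mul_smul,
            smul_smul (arrowSum K n ^ k), ← pow_add, Nat.add_sub_cancel' (by omega), hc,
            smul_smul, ← map_mul, div_mul_cancel₀ _ hc0, sub_self]
        have := Submodule.add_mem _ (ih (by omega) _ hzw) hw
        rwa [sub_add_cancel] at this
    rw [eq_top_iff]
    exact fun z _ => key (l + 1) le_rfl z (hzero z)
  · by_contra hne
    have h1 := idem_smul_of_ne (Ne.symm hne)
      (idem_smul_pow_smul (idem_smul_idem_smul (K := K) u x) l)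
    rw [hc, smul_smul, ← Algebra.commutes, mul_smul, hs] at h1
    exact hc0 (algebraMap_smul_eq_zero h1 h0)

/-- A nonzero element of the socle of a noetherian module survives in a quotient with
one-dimensional socle. -/
lemma exists_quotient_arrowKernel [IsNoetherian (CyclicAlgebra K n) X] {s : X} (h0 : s ≠ 0) :
    ∃ N : Submodule (CyclicAlgebra K n) X, N.mkQ s ≠ 0 ∧ ∀ x : X ⧸ N, arrowSum K n • x = 0 →
      ∃ c : K, x = algebraMap K (CyclicAlgebra K n) c • N.mkQ s := by
  -- N is maximal among the submodules that avoid s, so every nonzero submodule of the quotient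
  -- contains the image of s.
  obtain ⟨N, hsN, hmax⟩ := wellFounded_gt.has_min
    {N : Submodule (CyclicAlgebra K n) X | s ∉ N} ⟨⊥, h0⟩
  have hs : N.mkQ s ≠ 0 := fun h => hsN ((Submodule.Quotient.mk_eq_zero N).1 h)
  refine ⟨N, hs, ?_⟩
  have key : ∀ (v : CyclicQuiver n) (x : X ⧸ N), idem K v • x = x → arrowSum K n • x = 0 →
      ∃ c : K, x = algebraMap K (CyclicAlgebra K n) c • N.mkQ s := by
    intro v x hx ha
    by_cases hx0 : x = 0
    · exact ⟨0, by rw [hx0, map_zero, zero_smul]⟩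
    have hlt : N < (Submodule.span (CyclicAlgebra K n) {x}).comap N.mkQ := by
      refine lt_of_le_of_ne (Submodule.le_comap_mkQ _ _) fun h => hx0 ?_
      obtain ⟨z, rfl⟩ := N.mkQ_surjective x
      have : z ∈ N := by rw [h]; exact Submodule.mem_span_singleton_self _
      exact (Submodule.Quotient.mk_eq_zero N).2 this
    have hmem : s ∈ (Submodule.span (CyclicAlgebra K n) {x}).comap N.mkQ := by
      by_contra h
      exact hmax _ h hlt
    obtain ⟨r, hr⟩ := Submodule.mem_span_singleton.1 (Submodule.mem_comap.1 hmem)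
    rw [smul_eq_character_smul hx ha] at hr
    have hc : character K v r ≠ 0 := fun h => hs (by rw [← hr, h, map_zero, zero_smul])
    refine ⟨(character K v r)⁻¹, ?_⟩
    rw [← hr, smul_smul, ← map_mul, inv_mul_cancel₀ hc, map_one, one_smul]
  intro x hx
  have := fun v => key v (idem K v • x) (idem_smul_idem_smul v x)
    ((arrowKernel K n (X ⧸ N)).smul_mem (idem K v) hx)
  choose c hc using this
  refine ⟨∑ v, c v, ?_⟩
  rw [map_sum, Finset.sum_smul, ← Finset.sum_congr rfl fun v _ => hc v, sum_idem_smul]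

lemma HasSocleAt.idem_smul_eq {v : CyclicQuiver n} (h : HasSocleAt (K := K) {v} X) {x : X}
    (hx : arrowSum K n • x = 0) : idem K v • x = x := by
  conv_rhs => rw [← sum_idem_smul (K := K) (V := CyclicQuiver n) x]
  rw [Finset.sum_eq_single v (fun w _ hw => h x hx w hw)
    (fun h => absurd (Finset.mem_univ _) h)]

end Chain

/-! ### Supports of uniserial modules, and uniserial quotients -/

section Categorical

variable {K : Type u} [Field K] {n : ℕ} [NeZero n] {M N : ModuleCat.{u} (CyclicAlgebra K n)}

open scoped ModuleCat in
lemma IsChain.isOrdinary {u : CyclicQuiver n} {l : ℕ} {y : M} (h : IsChain K u l y) :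
    IsOrdinary K (CyclicQuiver n) M :=
  isOrdinary_iff.2 ⟨h.finiteDimensional, h.isArrowNilpotent⟩

lemma IsChain.isSupportedOn {u : CyclicQuiver n} {l : ℕ} {y : M} (h : IsChain K u l y)
    {R : Set (CyclicQuiver n)} (hR : ∀ i ≤ l, (succPerm n)^[i] u ∈ R) : IsSupportedOn R M := by
  intro v hv x
  induction x using h.induction with
  | add x z hx hz => rw [smul_add, hx, hz, add_zero]
  | smul c i hi =>
    rw [smul_smul, ← Algebra.commutes, mul_smul, idem_smul_of_ne (by rintro rfl; exact hv (hR i hi))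
      (idem_smul_pow_smul h.idem_smul i), smul_zero]

lemma IsSupportedOn.mem {R : Set (CyclicQuiver n)} (h : IsSupportedOn R M) {v : CyclicQuiver n}
    {x : M} (hx : idem K v • x = x) (h0 : x ≠ 0) : v ∈ R := by
  by_contra hv
  exact h0 (by rw [← hx, h v hv])

lemma IsChain.iterate_mem {u : CyclicQuiver n} {l : ℕ} {y : M} (h : IsChain K u l y)
    {R : Set (CyclicQuiver n)} (hR : IsSupportedOn R M) {i : ℕ} (hi : i ≤ l) :
    (succPerm n)^[i] u ∈ R :=
  hR.mem (idem_smul_pow_smul h.idem_smul i) (h.pow_smul_ne_zero hi)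

/-- The source of a nonzero map to a module with socle at `v` has a uniserial quotient with
socle at `v`. -/
lemma exists_isChain_quotient {R : Set (CyclicQuiver n)} {v : CyclicQuiver n}
    (hM : IsOrdinary K (CyclicQuiver n) M) (hN : IsSupportedOn R N)
    (hs : HasSocleAt (K := K) {v} N) {g : M →ₗ[CyclicAlgebra K n] N} (hg : g ≠ 0) :
    ∃ (Y : ModuleCat.{u} (CyclicAlgebra K n)) (π : M →ₗ[CyclicAlgebra K n] Y),
      Function.Surjective π ∧ IsSupportedOn R Y ∧
        ∃ u l, ∃ y : Y, IsChain K u l y ∧ (succPerm n)^[l] u = v := by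
  have hr : IsOrdinary K (CyclicQuiver n) (ModuleCat.of _ (LinearMap.range g)) :=
    hM.of_surjective (N := ModuleCat.of _ (LinearMap.range g)) g.rangeRestrict
      g.surjective_rangeRestrict
  have : IsNoetherian (CyclicAlgebra K n) (LinearMap.range g) :=
    IsOrdinary.isNoetherian (M := ModuleCat.of _ (LinearMap.range g)) hr
  have hnil : IsArrowNilpotent K n (LinearMap.range g) :=
    IsOrdinary.isArrowNilpotent (M := ModuleCat.of _ (LinearMap.range g)) hr
  have hsr : HasSocleAt (K := K) {v} (LinearMap.range g) :=
    hs.of_injective (LinearMap.range g).subtype Subtype.val_injective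
  obtain ⟨x, hx⟩ : ∃ x : LinearMap.range g, x ≠ 0 := by
    by_contra! h
    exact hg (LinearMap.ext fun x => congrArg Subtype.val (h (g.rangeRestrict x)))
  -- The last nonzero arrow multiple of x is in the socle of the image, hence at v. Dividing by a
  -- submodule maximal without it makes it span the socle, and the quotient is uniserial.
  obtain ⟨k, hk, hk'⟩ := hnil.exists_pow_smul hx
  obtain ⟨L, hL, hker⟩ := exists_quotient_arrowKernel (K := K) (n := n) hk
  refine ⟨ModuleCat.of _ (LinearMap.range g ⧸ L), L.mkQ.comp g.rangeRestrict,
    (L.mkQ_surjective).comp g.surjective_rangeRestrict, ?_, ?_⟩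
  · refine IsSupportedOn.of_surjective (M := ModuleCat.of _ (LinearMap.range g)) ?_ L.mkQ
      L.mkQ_surjective
    exact hN.of_injective (N := ModuleCat.of _ (LinearMap.range g)) (LinearMap.range g).subtype
      Subtype.val_injective
  · refine exists_isChain_of_arrowKernel ?_ ?_ hL hker
    · obtain ⟨m, hm⟩ := hnil
      refine ⟨m, fun x => ?_⟩
      obtain ⟨x, rfl⟩ := L.mkQ_surjective x
      rw [← map_smul, hm, map_zero]
    · rw [← map_smul, hsr.idem_smul_eq (by rw [smul_smul, ← pow_succ', hk'])]

end Categorical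

/-! ### Existence of uniserial modules -/

section Segment

variable (K : Type u) [Field K] {n : ℕ} [NeZero n] (u : CyclicQuiver n) (l : ℕ)

/-- The idempotent at `v` on the space with basis `0, …, l`, where `i` sits at the vertex
`u + i`. -/
def segmentIdem (v : CyclicQuiver n) : Module.End K (Fin (l + 1) → K) where
  toFun g i := if (succPerm n)^[i] u = v then g i else 0
  map_add' g g' := by ext i; simp only [Pi.add_apply]; split_ifs <;> simp
  map_smul' c g := by ext i; simp

/-- The shift of the standard basis of the space with basis `0, …, l`. -/
def segmentShift : Module.End K (Fin (l + 1) → K) where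
  toFun g := Fin.cons 0 fun i : Fin l => g i.castSucc
  map_add' g g' := by ext i; cases i using Fin.cases <;> simp
  map_smul' c g := by ext i; cases i using Fin.cases <;> simp

variable {K l} in
@[simp] lemma segmentIdem_apply (v : CyclicQuiver n) (g : Fin (l + 1) → K) (i : Fin (l + 1)) :
    segmentIdem K u l v g i = if (succPerm n)^[i] u = v then g i else 0 := rfl

variable {K l} in
@[simp] lemma segmentShift_zero (g : Fin (l + 1) → K) : segmentShift K l g 0 = 0 := rfl

variable {K l} in
@[simp] lemma segmentShift_succ (g : Fin (l + 1) → K) (i : Fin l) :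
    segmentShift K l g i.succ = g i.castSucc := rfl

/-- The action of the generators of the path algebra on the uniserial module with top at `u` and of
length `l + 1`. -/
def segmentGen : PathGen (CyclicQuiver n) → Module.End K (Fin (l + 1) → K)
  | .vertex v => segmentIdem K u l v
  | .arrow (a := v) (b := w) _ => segmentIdem K u l w * segmentShift K l * segmentIdem K u l v

lemma segmentIdem_mul_self (v : CyclicQuiver n) :
    segmentIdem K u l v * segmentIdem K u l v = segmentIdem K u l v := by
  refine LinearMap.ext fun g => funext fun i => ?_
  simp only [Module.End.mul_apply, segmentIdem_apply]
  split_ifs <;> rfl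

/-- The representation of the path algebra on the uniserial module with top at `u` and of length
`l + 1`. -/
noncomputable def segmentRep : CyclicAlgebra K n →ₐ[K] Module.End K (Fin (l + 1) → K) :=
  RingQuot.liftAlgHom K ⟨FreeAlgebra.lift K (segmentGen K u l), by
    intro x y h
    cases h with
    | idem v =>
      simp only [map_mul, FreeAlgebra.lift_ι_apply]
      exact segmentIdem_mul_self K u l v
    | orth v w h =>
      simp only [map_mul, FreeAlgebra.lift_ι_apply, map_zero]
      refine LinearMap.ext fun g => funext fun i => ?_
      change (if _ then (if _ then _ else _) else _) = (0 : K)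
      split_ifs with h1 h2
      · exact absurd (h1.symm.trans h2) h
      · rfl
      · rfl
    | sum =>
      simp only [map_sum, FreeAlgebra.lift_ι_apply, map_one]
      refine LinearMap.ext fun g => funext fun i => ?_
      simp [segmentGen, LinearMap.sum_apply, Finset.sum_apply]
    | arrow f =>
      simp only [map_mul, FreeAlgebra.lift_ι_apply]
      simp only [segmentGen]
      rw [mul_assoc, mul_assoc _ (segmentIdem K u l _) (segmentIdem K u l _), segmentIdem_mul_self,
        ← mul_assoc, ← mul_assoc, segmentIdem_mul_self]⟩

lemma segmentRep_idem (v : CyclicQuiver n) :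
    segmentRep K u l (idem K v) = segmentIdem K u l v := by
  unfold segmentRep idem PathAlgebra.mk
  erw [RingQuot.liftAlgHom_mkAlgHom_apply]
  exact FreeAlgebra.lift_ι_apply _ _

lemma segmentRep_arrowElt {v w : CyclicQuiver n} (f : v ⟶ w) :
    segmentRep K u l (arrowElt K f) =
      segmentIdem K u l w * segmentShift K l * segmentIdem K u l v := by
  unfold segmentRep arrowElt PathAlgebra.mk
  erw [RingQuot.liftAlgHom_mkAlgHom_apply]
  exact FreeAlgebra.lift_ι_apply _ _

lemma segmentRep_arrowSum : segmentRep K u l (arrowSum K n) = segmentShift K l := by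
  rw [arrowSum, map_sum]
  refine LinearMap.ext fun g => funext fun i => ?_
  simp only [segmentRep_arrowElt, LinearMap.sum_apply, Finset.sum_apply, Module.End.mul_apply,
    segmentIdem_apply]
  cases i using Fin.cases with
  | zero => simp only [segmentShift_zero, ite_self, Finset.sum_const_zero]
  | succ i =>
    simp only [segmentShift_succ, segmentIdem_apply, Fin.val_succ, Fin.val_castSucc,
      Function.iterate_succ_apply', EmbeddingLike.apply_eq_iff_eq]
    rw [Finset.sum_eq_single ((succPerm n)^[i] u)]
    · simp
    · intro v _ hv
      rw [if_neg (Ne.symm hv)]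
    · exact fun h => absurd (Finset.mem_univ _) h

lemma exists_isChain : ∃ (X : ModuleCat.{u} (CyclicAlgebra K n)) (y : X), IsChain K u l y := by
  let _ : Module (CyclicAlgebra K n) (Fin (l + 1) → K) :=
    Module.compHom (Fin (l + 1) → K) (segmentRep K u l).toRingHom
  have hsmul : ∀ (r : CyclicAlgebra K n) (g : Fin (l + 1) → K), r • g = segmentRep K u l r g :=
    fun _ _ => rfl
  -- The k-th standard basis vector, indexed by all naturals: it is zero for k > l, which gives the
  -- vanishing of the power l+1.
  let y : ℕ → Fin (l + 1) → K := fun k i => if (i : ℕ) = k then 1 else 0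
  have hy : ∀ k, arrowSum K n • y k = y (k + 1) := by
    intro k
    rw [hsmul, segmentRep_arrowSum]
    ext i
    cases i using Fin.cases <;> simp [y]
  have hpow : ∀ k, arrowSum K n ^ k • y 0 = y k := by
    intro k
    induction k with
    | zero => rw [pow_zero, one_smul]
    | succ k ih => rw [pow_succ', mul_smul, ih, hy]
  refine ⟨ModuleCat.of _ (Fin (l + 1) → K), y 0, ?_, ?_, ?_, ?_⟩
  · change idem K u • y 0 = y 0
    rw [hsmul, segmentRep_idem]
    ext i
    cases i using Fin.cases <;> simp [y]
  · change arrowSum K n ^ l • y 0 ≠ 0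
    rw [hpow]
    exact fun h => by simpa [y] using congrFun h (Fin.last l)
  · change arrowSum K n ^ (l + 1) • y 0 = 0
    rw [hpow]
    ext i
    exact if_neg (by omega)
  · change Submodule.span (CyclicAlgebra K n) {y 0} = ⊤
    rw [eq_top_iff]
    rintro g -
    have hg : g = ∑ i : Fin (l + 1), algebraMap K (CyclicAlgebra K n) (g i) • y i := by
      ext j
      rw [Finset.sum_apply, Finset.sum_eq_single j]
      · rw [hsmul, AlgHom.commutes]
        simp [y]
      · intro i _ hi
        rw [hsmul, AlgHom.commutes]
        simp [y, Fin.val_inj, hi.symm]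
      · exact fun h => absurd (Finset.mem_univ _) h
    rw [hg]
    refine Submodule.sum_mem _ fun i _ => Submodule.smul_mem _ _ ?_
    exact Submodule.mem_span_singleton.2 ⟨_, hpow i⟩

end Segment

/-! ### Uniserial modules are the indecomposable modules with simple top or socle -/

section Chain

variable {K : Type u} [Field K] {n : ℕ} [NeZero n]

/-- The generator of the simple module at a vertex. -/
def SimpleAt.generator (K : Type u) [Field K] {V : Type} (v : V) : SimpleAt K v := (1 : K)

lemma isChain_simpleAt (v : CyclicQuiver n) : IsChain K v 0 (SimpleAt.generator K v) where
  idem_smul := by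
    rw [simpleAt_smul_def, character_idem, if_pos rfl]
    exact one_mul (1 : K)
  ne_zero := by
    rw [pow_zero, one_smul]
    exact one_ne_zero (α := K)
  pow_smul := by
    rw [zero_add, pow_one]
    exact simpleAt_smul_eq_zero (character_arrowSum v) _
  span_eq_top := by
    rw [eq_top_iff]
    intro x _
    refine Submodule.mem_span_singleton.2 ⟨algebraMap K _ (show K from x), ?_⟩
    rw [simpleAt_smul_def, AlgHom.commutes]
    exact mul_one (show K from x)

lemma exists_eq_algebraMap_smul_simpleAt {v : CyclicQuiver n} (x : SimpleAt K v) :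
    ∃ c : K, x = algebraMap K (CyclicAlgebra K n) c • (SimpleAt.generator K v) := by
  refine ⟨show K from x, ?_⟩
  rw [simpleAt_smul_def, AlgHom.commutes]
  exact (mul_one (show K from x)).symm

variable {X : Type*} [AddCommGroup X] [Module (CyclicAlgebra K n) X]

lemma IsChain.nonempty_topQuotient [Module K X] [IsScalarTower K (CyclicAlgebra K n) X]
    {u : CyclicQuiver n} {l : ℕ} {y : X} (h : IsChain K u l y) :
    Nonempty (TopQuotient (CyclicAlgebra K n) X ≃ₗ[CyclicAlgebra K n] SimpleAt K u) := by
  have := h.finiteDimensional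
  have ha : ∀ x : SimpleAt K u, arrowSum K n • x = 0 :=
    simpleAt_smul_eq_zero (character_arrowSum u)
  obtain ⟨f, hf⟩ := h.exists_hom (isChain_simpleAt (K := K) u).idem_smul
    (by rw [pow_succ, mul_smul, ha, smul_zero])
  have hsurj : Function.Surjective f := by
    intro x
    obtain ⟨c, rfl⟩ := exists_eq_algebraMap_smul_simpleAt x
    exact ⟨algebraMap K (CyclicAlgebra K n) c • y, by rw [map_smul, hf]⟩
  have hker : LinearMap.ker f = Module.jacobson (CyclicAlgebra K n) X := by
    rw [jacobson_eq_arrowImage h.isArrowNilpotent]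
    apply le_antisymm
    · intro x hx
      obtain ⟨c, z, rfl⟩ := h.exists_arrowImage x
      rw [LinearMap.mem_ker, map_add, map_smul, map_smul, hf, ha, add_zero] at hx
      rw [algebraMap_smul_eq_zero hx (one_ne_zero (α := K)), map_zero, zero_smul, zero_add]
      exact ⟨z, trivial, rfl⟩
    · rintro _ ⟨z, -, rfl⟩
      rw [LinearMap.mem_ker, map_smul, ha]
  unfold TopQuotient
  rw [← hker]
  exact ⟨LinearMap.quotKerEquivOfSurjective f hsurj⟩

lemma IsChain.nonempty_socle {u : CyclicQuiver n} {l : ℕ} {y : X} (h : IsChain K u l y) :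
    Nonempty (socle (CyclicAlgebra K n) X ≃ₗ[CyclicAlgebra K n]
      SimpleAt K ((succPerm n)^[l] u)) := by
  obtain ⟨f, hf⟩ := (isChain_simpleAt (K := K) ((succPerm n)^[l] u)).exists_hom
    (idem_smul_pow_smul h.idem_smul l) (by rw [zero_add, pow_one, smul_smul, ← pow_succ', h.pow_smul])
  have hinj : Function.Injective f := by
    rw [injective_iff_map_eq_zero]
    intro x hx
    obtain ⟨c, rfl⟩ := exists_eq_algebraMap_smul_simpleAt x
    rw [map_smul, hf] at hx
    rw [algebraMap_smul_eq_zero hx h.ne_zero, map_zero, zero_smul]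
  have hrange : LinearMap.range f = socle (CyclicAlgebra K n) X := by
    rw [socle_eq_arrowKernel h.isArrowNilpotent]
    apply le_antisymm
    · rintro _ ⟨x, rfl⟩
      rw [mem_arrowKernel, ← map_smul, simpleAt_smul_eq_zero (character_arrowSum _), map_zero]
    · intro x hx
      obtain ⟨c, rfl⟩ := h.exists_eq_smul_of_arrowSum_smul hx
      exact ⟨algebraMap K (CyclicAlgebra K n) c • SimpleAt.generator K _, by
        rw [map_smul, hf]⟩
  rw [← hrange]
  exact ⟨(LinearEquiv.ofInjective f hinj).symm⟩

/-- Lift a generator of the top and project the lift to v. By Nakayama it generates the whole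
module. -/
lemma exists_isChain_of_topQuotient [Module K X] [IsScalarTower K (CyclicAlgebra K n) X]
    [FiniteDimensional K X] (hX : IsArrowNilpotent K n X) {v : CyclicQuiver n}
    (e : TopQuotient (CyclicAlgebra K n) X ≃ₗ[CyclicAlgebra K n] SimpleAt K v) :
    ∃ l, ∃ y : X, IsChain K v l y := by
  obtain ⟨x, hx⟩ := Submodule.mkQ_surjective _ (e.symm (SimpleAt.generator K v))
  have hy : e (Submodule.mkQ _ (idem K v • x)) = (SimpleAt.generator K v) := by
    rw [map_smul, hx, map_smul, e.apply_symm_apply, (isChain_simpleAt (K := K) v).idem_smul]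
  have h0 : idem K v • x ≠ 0 := by
    intro h
    rw [h, map_zero, map_zero] at hy
    exact zero_ne_one (α := K) hy
  obtain ⟨l, h1, h2⟩ := hX.exists_pow_smul h0
  refine ⟨l, _, idem_smul_idem_smul v x, h1, h2, eq_top_of_sup_arrowImage hX fun z => ?_⟩
  obtain ⟨c, hc⟩ := exists_eq_algebraMap_smul_simpleAt (e (Submodule.mkQ _ z))
  have hz : z - algebraMap K (CyclicAlgebra K n) c • idem K v • x ∈
      Module.jacobson (CyclicAlgebra K n) X := by
    rw [← Submodule.Quotient.mk_eq_zero]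
    apply e.injective
    change e (Submodule.mkQ _ _) = _
    rw [map_sub, map_smul, map_sub, map_smul, hy, hc, sub_self, map_zero]
  rw [jacobson_eq_arrowImage hX] at hz
  obtain ⟨w, -, hw⟩ := hz
  exact ⟨_, Submodule.smul_mem _ _ (Submodule.mem_span_singleton_self _), w, by
    rw [hw, add_sub_cancel]⟩

lemma exists_isChain_of_socle (hX : IsArrowNilpotent K n X) {v : CyclicQuiver n}
    (e : socle (CyclicAlgebra K n) X ≃ₗ[CyclicAlgebra K n] SimpleAt K v) :
    ∃ u l, ∃ y : X, IsChain K u l y ∧ (succPerm n)^[l] u = v := by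
  refine exists_isChain_of_arrowKernel hX
    (s := (e.symm (SimpleAt.generator K v) : socle (CyclicAlgebra K n) X)) ?_ ?_ ?_
  · rw [← Submodule.coe_smul, ← map_smul, (isChain_simpleAt (K := K) v).idem_smul]
  · intro h
    have h1 := e.symm.map_eq_zero_iff.1 (Subtype.ext h)
    exact one_ne_zero (α := K) h1
  · intro x hx
    rw [← mem_arrowKernel, ← socle_eq_arrowKernel hX] at hx
    obtain ⟨c, hc⟩ := exists_eq_algebraMap_smul_simpleAt (e ⟨x, hx⟩)
    refine ⟨c, ?_⟩
    rw [← Submodule.coe_smul, ← map_smul, ← hc, e.symm_apply_apply]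

variable {M N : ModuleCat.{u} (CyclicAlgebra K n)}

/-- Every nonzero submodule contains the one-dimensional socle, so two nonzero submodules cannot be
complementary summands. -/
lemma IsChain.indecomposable {u : CyclicQuiver n} {l : ℕ} {y : M} (h : IsChain K u l y) :
    Indecomposable M := by
  refine ⟨fun h0 => ?_, fun Y Z e => ?_⟩
  · have := ModuleCat.subsingleton_of_isZero h0
    exact h.ne_zero (Subsingleton.elim _ _)
  · by_contra! hYZ
    have key : ∀ (W : ModuleCat.{u} (CyclicAlgebra K n)) (i : W ⟶ M), Mono i → ¬ IsZero W →
        ∃ (w : W) (c : K), w ≠ 0 ∧ c ≠ 0 ∧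
          i w = algebraMap K (CyclicAlgebra K n) c • arrowSum K n ^ l • y := by
      intro W i hi hW
      have hinj : Function.Injective i := (ModuleCat.mono_iff_injective i).1 hi
      obtain ⟨w, hw⟩ : ∃ w : W, w ≠ 0 := by
        by_contra! h'
        have : Subsingleton W := ⟨fun a b => (h' a).trans (h' b).symm⟩
        exact hW (ModuleCat.isZero_of_subsingleton W)
      have hnil : IsArrowNilpotent K n W :=
        (h.isOrdinary.of_injective i.hom hinj).isArrowNilpotent
      obtain ⟨k, hk, hk'⟩ := hnil.exists_pow_smul hw
      obtain ⟨c, hc⟩ := h.exists_eq_smul_of_arrowSum_smul (x := i.hom (arrowSum K n ^ k • w))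
        (by rw [← map_smul, smul_smul, ← pow_succ', hk', map_zero])
      refine ⟨_, c, hk, ?_, hc⟩
      rintro rfl
      rw [map_zero, zero_smul] at hc
      exact hk (hinj (hc.trans (map_zero i.hom).symm))
    obtain ⟨w, c, hw, hc, hiw⟩ := key Y (biprod.inl ≫ e.inv) inferInstance hYZ.1
    obtain ⟨z, d, -, hd, hiz⟩ := key Z (biprod.inr ≫ e.inv) inferInstance hYZ.2
    have h1 : (biprod.inl ≫ e.inv : Y ⟶ M) w =
        algebraMap K (CyclicAlgebra K n) (c / d) • (biprod.inr ≫ e.inv : Z ⟶ M) z := by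
      rw [hiw, hiz, smul_smul (algebraMap K (CyclicAlgebra K n) (c / d)), ← map_mul,
        div_mul_cancel₀ _ hd]
    have h2 := congrArg (e.hom ≫ biprod.fst : M ⟶ Y) h1
    rw [map_smul, ← ConcreteCategory.comp_apply, ← ConcreteCategory.comp_apply] at h2
    simp only [Category.assoc, Iso.inv_hom_id_assoc, biprod.inl_fst, biprod.inr_fst] at h2
    exact hw (h2.trans (smul_zero _))

end Chain

/-! ### Torsion pairs and extension closures -/

section TorsionGeneral

variable {A : Type u} [Ring A] {C P Q : ObjectProperty (ModuleCat.{u} A)}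

lemma shortExact_of_exact {X Y Z : ModuleCat.{u} A} {f : X →ₗ[A] Y} {g : Y →ₗ[A] Z}
    (hf : Function.Injective f) (hfg : Function.Exact f g) (hg : Function.Surjective g) :
    (ShortComplex.mk (ModuleCat.ofHom f) (ModuleCat.ofHom g)
      (ModuleCat.hom_ext hfg.linearMap_comp_eq_zero)).ShortExact :=
  ModuleCat.shortComplex_shortExact _ hfg hf hg

lemma ExtClosure.of_exact {X Y Z : ModuleCat.{u} A} (hX : ExtClosure P X) (hZ : ExtClosure P Z)
    (f : X →ₗ[A] Y) (g : Y →ₗ[A] Z) (hf : Function.Injective f) (hfg : Function.Exact f g)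
    (hg : Function.Surjective g) : ExtClosure P Y :=
  ExtClosure.ext _ (shortExact_of_exact hf hfg hg) hX hZ

lemma ExtClosure.of_linearEquiv {X Y : ModuleCat.{u} A} (hX : ExtClosure P X) (e : X ≃ₗ[A] Y) :
    ExtClosure P Y := by
  refine hX.of_exact (ExtClosure.zero (ModuleCat.of A PUnit.{u + 1})
    (ModuleCat.isZero_of_subsingleton _)) e.toLinearMap 0 e.injective ?_ ?_
  · exact fun y => ⟨fun _ => e.surjective y, fun _ => rfl⟩
  · exact fun y => ⟨0, Subsingleton.elim _ _⟩

lemma ExtClosure.isClosedUnderIsomorphisms :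
    ObjectProperty.IsClosedUnderIsomorphisms (ExtClosure P) :=
  ⟨fun e hX => hX.of_linearEquiv e.toLinearEquiv⟩

lemma ExtClosure.le_of_forall (hP : P ≤ C) (h0 : ∀ X, IsZero X → C X)
    (hC : ∀ S : ShortComplex (ModuleCat.{u} A), S.ShortExact → C S.X₁ → C S.X₃ → C S.X₂) :
    ExtClosure P ≤ C := by
  intro X hX
  induction hX with
  | of X h => exact hP X h
  | zero X h => exact h0 X h
  | ext S hS _ _ h₁ h₃ => exact hC S hS h₁ h₃

/-- Vanishing of Hom passes through extensions in the target, by lifting to the kernel, and then in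
the source, by descending to the cokernel. -/
lemma ExtClosure.hom_eq_zero (h : ∀ X Y, P X → Q Y → ∀ f : X ⟶ Y, f = 0) {X Y : ModuleCat.{u} A}
    (hX : ExtClosure P X) (hY : ExtClosure Q Y) (f : X ⟶ Y) : f = 0 := by
  have key : ∀ X, P X → ∀ f : X ⟶ Y, f = 0 := by
    intro X hX
    clear f
    induction hY with
    | of Y hY => exact h X Y hX hY
    | zero Y hY => exact fun f => hY.eq_of_tgt f 0
    | ext S hS _ _ h₁ h₃ =>
      intro f
      have := hS.mono_f
      rw [← hS.exact.lift_f f (h₃ _), h₁ (hS.exact.lift f (h₃ _)), zero_comp]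
  induction hX with
  | of X hX => exact key X hX f
  | zero X hX => exact hX.eq_of_src f 0
  | ext S hS _ _ h₁ h₃ =>
    have := hS.epi_g
    rw [← hS.exact.g_desc f (h₁ _), h₃ (hS.exact.desc f (h₁ _)), comp_zero]

namespace TorsionPair

variable (p : TorsionPair C)

/-- T is the left Hom-orthogonal of F: if X has no maps to F, the torsion-free quotient in its
sequence vanishes and X is its own torsion part. All closure properties of T come from this, and
those of F from `F_iff`. -/
lemma T_iff {X : ModuleCat.{u} A} :
    p.T X ↔ C X ∧ ∀ Y : ModuleCat.{u} A, p.F Y → ∀ f : X →ₗ[A] Y, f = 0 := by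
  constructor
  · exact fun hX => ⟨p.le_T X hX, fun Y hY f =>
      congrArg ModuleCat.Hom.hom (p.hom_zero X Y hX hY (ModuleCat.ofHom f))⟩
  · rintro ⟨hX, h⟩
    obtain ⟨S, hS, h₁, rfl, h₃⟩ := p.exists_seq X hX
    have hg : S.g = 0 := ModuleCat.hom_ext (h S.X₃ h₃ S.g.hom)
    have := hS.mono_f
    have := hS.exact.epi_f hg
    have := isIso_of_mono_of_epi S.f
    have := p.iso_T
    exact p.T.prop_of_iso (asIso S.f) h₁

lemma F_iff {Y : ModuleCat.{u} A} :
    p.F Y ↔ C Y ∧ ∀ X : ModuleCat.{u} A, p.T X → ∀ f : X →ₗ[A] Y, f = 0 := by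
  constructor
  · exact fun hY => ⟨p.le_F Y hY, fun X hX f =>
      congrArg ModuleCat.Hom.hom (p.hom_zero X Y hX hY (ModuleCat.ofHom f))⟩
  · rintro ⟨hY, h⟩
    obtain ⟨S, hS, h₁, rfl, h₃⟩ := p.exists_seq Y hY
    have hf : S.f = 0 := ModuleCat.hom_ext (h S.X₁ h₁ S.f.hom)
    have := hS.epi_g
    have := hS.exact.mono_g hf
    have := isIso_of_mono_of_epi S.g
    have := p.iso_F
    exact p.F.prop_of_iso (asIso S.g).symm h₃

variable {p}

lemma hom_eq_zero {X Y : ModuleCat.{u} A} (hX : p.T X) (hY : p.F Y) (f : X →ₗ[A] Y) : f = 0 :=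
  (p.T_iff.1 hX).2 Y hY f

lemma T_of_surjective {X Y : ModuleCat.{u} A} (hX : p.T X) (hY : C Y) (f : X →ₗ[A] Y)
    (hf : Function.Surjective f) : p.T Y := by
  refine p.T_iff.2 ⟨hY, fun Z hZ g => LinearMap.ext fun y => ?_⟩
  obtain ⟨x, rfl⟩ := hf y
  exact LinearMap.congr_fun (hom_eq_zero hX hZ (g.comp f)) x

lemma F_of_injective {X Y : ModuleCat.{u} A} (hY : p.F Y) (hX : C X) (f : X →ₗ[A] Y)
    (hf : Function.Injective f) : p.F X := by
  refine p.F_iff.2 ⟨hX, fun Z hZ g => LinearMap.ext fun z => hf ?_⟩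
  rw [LinearMap.zero_apply, map_zero]
  exact LinearMap.congr_fun (hom_eq_zero hZ hY (f.comp g)) z

lemma extClosure_le_T (h0 : ∀ X, IsZero X → C X)
    (hC : ∀ S : ShortComplex (ModuleCat.{u} A), S.ShortExact → C S.X₁ → C S.X₃ → C S.X₂)
    (hP : P ≤ p.T) : ExtClosure P ≤ p.T := by
  refine ExtClosure.le_of_forall hP
    (fun X hX => p.T_iff.2 ⟨h0 X hX, fun Y _ f => ?_⟩) fun S hS h₁ h₃ => ?_
  · exact congrArg ModuleCat.Hom.hom (hX.eq_of_src (ModuleCat.ofHom f) 0)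
  · refine p.T_iff.2 ⟨hC S hS (p.le_T _ h₁) (p.le_T _ h₃), fun Y hY f => ?_⟩
    have := hS.epi_g
    have h := p.hom_zero _ _ h₁ hY (S.f ≫ ModuleCat.ofHom f)
    have h' := hS.exact.g_desc (ModuleCat.ofHom f) h
    rw [p.hom_zero _ _ h₃ hY (hS.exact.desc _ h), comp_zero] at h'
    exact congrArg ModuleCat.Hom.hom h'.symm

lemma extClosure_le_F (h0 : ∀ X, IsZero X → C X)
    (hC : ∀ S : ShortComplex (ModuleCat.{u} A), S.ShortExact → C S.X₁ → C S.X₃ → C S.X₂)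
    (hP : P ≤ p.F) : ExtClosure P ≤ p.F := by
  refine ExtClosure.le_of_forall hP
    (fun X hX => p.F_iff.2 ⟨h0 X hX, fun Y _ f => ?_⟩) fun S hS h₁ h₃ => ?_
  · exact congrArg ModuleCat.Hom.hom (hX.eq_of_tgt (ModuleCat.ofHom f) 0)
  · refine p.F_iff.2 ⟨hC S hS (p.le_F _ h₁) (p.le_F _ h₃), fun Y hY f => ?_⟩
    have := hS.mono_f
    have h := p.hom_zero _ _ hY h₃ (ModuleCat.ofHom f ≫ S.g)
    have h' := hS.exact.lift_f (ModuleCat.ofHom f) h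
    rw [p.hom_zero _ _ hY h₁ (hS.exact.lift _ h), zero_comp] at h'
    exact congrArg ModuleCat.Hom.hom h'.symm

/-- A torsion pair is determined by classes in it that generate enough short exact sequences. -/
lemma eq_extClosure (hP : ExtClosure P ≤ p.T) (hQ : ExtClosure Q ≤ p.F)
    (h : ∀ X, C X → ∃ t : Submodule A X, ExtClosure P (ModuleCat.of A t) ∧
      ExtClosure Q (ModuleCat.of A (X ⧸ t))) :
    p.T = ExtClosure P ∧ p.F = ExtClosure Q := by
  constructor
  · refine le_antisymm (fun X hX => ?_) hP
    obtain ⟨t, ht, hq⟩ := h X (p.le_T X hX)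
    have h0 : t.mkQ = 0 := hom_eq_zero (Y := ModuleCat.of A (X ⧸ t)) hX (hQ _ hq) t.mkQ
    have htop : t = ⊤ := by rw [← t.ker_mkQ, h0, LinearMap.ker_zero]
    exact ht.of_linearEquiv (LinearEquiv.ofTop t htop)
  · refine le_antisymm (fun X hX => ?_) hQ
    obtain ⟨t, ht, hq⟩ := h X (p.le_F X hX)
    have h0 : t.subtype = 0 := hom_eq_zero (X := ModuleCat.of A t) (hP _ ht) hX t.subtype
    have hbot : t = ⊥ := by rw [← t.range_subtype, h0, LinearMap.range_zero]
    exact hq.of_linearEquiv (Submodule.quotEquivOfEqBot t hbot)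

/-- The torsion pair generated by two classes of modules. -/
def ofExtClosure (hP : ExtClosure P ≤ C) (hQ : ExtClosure Q ≤ C)
    (hPQ : ∀ X Y, P X → Q Y → ∀ f : X ⟶ Y, f = 0)
    (h : ∀ X, C X → ∃ t : Submodule A X, ExtClosure P (ModuleCat.of A t) ∧
      ExtClosure Q (ModuleCat.of A (X ⧸ t))) : TorsionPair C where
  T := ExtClosure P
  F := ExtClosure Q
  le_T := hP
  le_F := hQ
  iso_T := ExtClosure.isClosedUnderIsomorphisms
  iso_F := ExtClosure.isClosedUnderIsomorphisms
  hom_zero _ _ hX hY f := hX.hom_eq_zero hPQ hY f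
  exists_seq X hX := by
    obtain ⟨t, ht, hq⟩ := h X hX
    exact ⟨_, shortExact_of_exact (X := ModuleCat.of A t) (Z := ModuleCat.of A (X ⧸ t))
      Subtype.val_injective (LinearMap.exact_subtype_mkQ t) t.mkQ_surjective, ht, rfl, hq⟩

lemma ext_of_eq {p q : TorsionPair C} (hT : p.T = q.T) (hF : p.F = q.F) : p = q := by
  cases p
  cases q
  cases hT
  cases hF
  rfl

end TorsionPair

end TorsionGeneral

/-! ### Extensions of ordinary modules; trace and reject at a set of vertices -/

section Ordinary

variable {K : Type u} [Field K] {n : ℕ} [NeZero n]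

lemma isOrdinary_of_isZero (X : ModuleCat.{u} (CyclicAlgebra K n)) (hX : IsZero X) :
    IsOrdinary K (CyclicQuiver n) X := by
  have := ModuleCat.subsingleton_of_isZero hX
  exact isOrdinary_of_subsingleton

lemma isOrdinary_of_shortExact (S : ShortComplex (ModuleCat.{u} (CyclicAlgebra K n)))
    (hS : S.ShortExact) (h₁ : IsOrdinary K (CyclicQuiver n) S.X₁)
    (h₃ : IsOrdinary K (CyclicQuiver n) S.X₃) : IsOrdinary K (CyclicQuiver n) S.X₂ :=
  isOrdinary_of_exact h₁ h₃ ((ShortComplex.ShortExact.moduleCat_exact_iff_function_exact S).1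
    hS.exact) hS.moduleCat_surjective_g

variable {X : Type*} [AddCommGroup X] [Module (CyclicAlgebra K n) X]

variable (K X) in
/-- The submodule generated by the elements at the vertices in `D`. -/
noncomputable def traceAt (D : Set (CyclicQuiver n)) : Submodule (CyclicAlgebra K n) X :=
  Submodule.span (CyclicAlgebra K n) {x : X | ∃ v ∈ D, idem K v • x = x}

variable (K X) in
/-- The largest submodule that is zero at the vertices in `D`. -/
noncomputable def rejectAt (D : Set (CyclicQuiver n)) : Submodule (CyclicAlgebra K n) X where
  carrier := {x | ∀ r : CyclicAlgebra K n, ∀ v ∈ D, idem K v • r • x = 0}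
  zero_mem' := fun r v _ => by rw [smul_zero, smul_zero]
  add_mem' := fun hx hy r v hv => by rw [smul_add, smul_add, hx r v hv, hy r v hv, add_zero]
  smul_mem' := fun s x hx r v hv => by rw [smul_smul r, hx (r * s) v hv]

lemma idem_smul_eq_zero_of_mem_rejectAt {D : Set (CyclicQuiver n)} {x : X}
    (hx : x ∈ rejectAt K X D) {v : CyclicQuiver n} (hv : v ∈ D) : idem K v • x = 0 := by
  simpa using hx 1 v hv

lemma isGeneratedAt_traceAt (D : Set (CyclicQuiver n)) :
    IsGeneratedAt (K := K) D (traceAt K X D) := by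
  have h := Submodule.span_span_coe_preimage (R := CyclicAlgebra K n)
    (s := {x : X | ∃ v ∈ D, idem K v • x = x})
  unfold IsGeneratedAt traceAt
  refine top_le_iff.1 (h.ge.trans (Submodule.span_mono ?_))
  rintro ⟨x, hx⟩ ⟨v, hv, h⟩
  exact ⟨v, hv, Subtype.ext h⟩

lemma idem_smul_quotient_traceAt {D : Set (CyclicQuiver n)} (x : X ⧸ traceAt K X D)
    {v : CyclicQuiver n} (hv : v ∈ D) : idem K v • x = 0 := by
  obtain ⟨x, rfl⟩ := Submodule.mkQ_surjective _ x
  exact (Submodule.Quotient.mk_eq_zero _).2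
    (Submodule.subset_span ⟨v, hv, idem_smul_idem_smul v x⟩)

/-- Let x be killed by the arrows modulo the reject, and v not in D. Paths of positive length send
the component of x at v into the reject, and the trivial path leaves it at v, outside D. So the
component itself is in the reject. -/
lemma hasSocleAt_quotient_rejectAt (D : Set (CyclicQuiver n)) :
    HasSocleAt (K := K) D (X ⧸ rejectAt K X D) := by
  intro x hx v hv
  obtain ⟨x, rfl⟩ := Submodule.mkQ_surjective _ x
  have hz : arrowSum K n • idem K v • x ∈ rejectAt K X D := by
    rw [← idem_succ_smul_arrowSum_smul]
    exact Submodule.smul_mem _ _ ((Submodule.Quotient.mk_eq_zero _).1 hx)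
  refine (Submodule.Quotient.mk_eq_zero _).2 fun r w hw => ?_
  obtain ⟨p, -, hp⟩ := exists_aeval_smul (X := X) r v
  rw [hp _ (idem_smul_idem_smul v x), ← p.divX_mul_X_add, map_add, map_mul, Polynomial.aeval_X,
    Polynomial.aeval_C, add_smul, smul_add, mul_smul, hz _ w hw, zero_add, smul_smul,
    ← Algebra.commutes, mul_smul, idem_smul_of_ne (by rintro rfl; exact hv hw)
      (idem_smul_idem_smul v x), smul_zero]

end Ordinary

/-! ### The torsion pair of a part partition -/

namespace PartTuple

section Combinatorics

variable {V : Type} (S : PartTuple V)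

/-- The vertices that remain after removing the first `j` parts. -/
def restNat (j : ℕ) : Set V := {v | ∀ i : Fin (S.m + 1), i.val < j → v ∉ S.part i}

lemma restNat_succ (j : Fin (S.m + 1)) : S.restNat (j.val + 1) = S.restNat j.val \ S.part j := by
  ext v
  constructor
  · exact fun h => ⟨fun i hi => h i (by omega), h j (by omega)⟩
  · rintro ⟨h, hj⟩ i hi
    rcases Nat.lt_succ_iff_lt_or_eq.1 hi with hi | hi
    · exact h i hi
    · rwa [Fin.ext hi]

lemma part_subset_restNat (j : Fin (S.m + 1)) : S.part j ⊆ S.restNat j.val :=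
  fun _ hv i hi hvi => Set.disjoint_left.1 (S.disjoint i j (by rintro rfl; omega)) hvi hv

variable {S} in
lemma IsComplete.restNat_eq_empty (hS : S.IsComplete) : S.restNat (S.m + 1) = ∅ := by
  rw [Set.eq_empty_iff_forall_notMem]
  intro v hv
  obtain ⟨i, hi⟩ := hS v
  exact hv i i.isLt hi

end Combinatorics

variable {K : Type u} [Field K] {n : ℕ} [NeZero n] (S : PartTuple (CyclicQuiver n))
variable {P P' : ℕ → Prop}

/-- P marks the indices of corays and P' those of rays, so the indices i and j differ. If i < j, the
target vanishes at Δ_i, where the source is generated. If j < i, a nonzero image would contain a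
socle element with a component at Δ_j, where the source vanishes. -/
lemma hom_eq_zero_of_corays_of_rays (hP : ∀ j, P' j ↔ ¬ P j)
    {X Y : ModuleCat.{u} (CyclicAlgebra K n)}
    (hX : S.corays K P X) (hY : S.rays K P' Y) (f : X ⟶ Y) : f = 0 := by
  obtain ⟨i, hi, hX⟩ := hX
  obtain ⟨j, hj, hY⟩ := hY
  obtain ⟨hXo, hXs, hXg⟩ := coray_iff.1 hX
  obtain ⟨hYo, hYs, hYg⟩ := ray_iff.1 hY
  refine ModuleCat.hom_ext (hXg.eq_zero f.hom fun v hv x hx => ?_)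
  rcases lt_trichotomy i j with hij | rfl | hij
  · rw [← hx, map_smul, hYs v (fun h => h i hij hv)]
  · exact absurd hi ((hP _).1 hj)
  · by_contra h0
    obtain ⟨k, hk, hk'⟩ := hYo.isArrowNilpotent.exists_pow_smul h0
    have h1 : ∀ w : CyclicQuiver n, idem K w • arrowSum K n ^ k • f.hom x = 0 := by
      intro w
      by_cases hw : w ∈ S.part j
      · rw [← map_smul, ← map_smul, hXs w (fun h => h j hij hw), map_zero]
      · exact hYg _ (by rw [smul_smul, ← pow_succ', hk']) w hw
    apply hk
    rw [← sum_idem_smul (K := K) (V := CyclicQuiver n) (arrowSum K n ^ k • f.hom x)]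
    exact Finset.sum_eq_zero fun w _ => h1 w

-- Induction on the number k of parts still to be used, for modules supported on what remains. At a
-- torsion index the trace of Δ_j is a coray and the quotient by it lives on the next remainder; at
-- the other indices the quotient by the reject is a ray and the reject lives there.
variable {S} in
lemma IsComplete.exists_submodule (hP : ∀ j, P' j ↔ ¬ P j) (hS : S.IsComplete) (k : ℕ) :
    ∀ j, j + k = S.m + 1 → ∀ X : ModuleCat.{u} (CyclicAlgebra K n),
      IsOrdinary K (CyclicQuiver n) X → IsSupportedOn (S.restNat j) X →
      ∃ t : Submodule (CyclicAlgebra K n) X,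
        ExtClosure (S.corays K P) (ModuleCat.of (CyclicAlgebra K n) t) ∧
        ExtClosure (S.rays K P') (ModuleCat.of (CyclicAlgebra K n) (X ⧸ t)) := by
  induction k with
  | zero =>
    intro j hj X _ hX
    obtain rfl : j = S.m + 1 := by omega
    rw [hS.restNat_eq_empty] at hX
    have h0 : ∀ x : X, x = 0 := fun x => by
      rw [← sum_idem_smul (K := K) (V := CyclicQuiver n) x]
      exact Finset.sum_eq_zero fun v _ => hX v (Set.notMem_empty v) x
    have : Subsingleton X := ⟨fun x y => (h0 x).trans (h0 y).symm⟩
    have : Subsingleton (X ⧸ (⊥ : Submodule (CyclicAlgebra K n) X)) :=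
      (Submodule.mkQ_surjective _).subsingleton
    exact ⟨⊥, .zero _ (ModuleCat.isZero_of_subsingleton (ModuleCat.of (CyclicAlgebra K n)
        (⊥ : Submodule (CyclicAlgebra K n) X))),
      .zero _ (ModuleCat.isZero_of_subsingleton (ModuleCat.of (CyclicAlgebra K n)
        (X ⧸ (⊥ : Submodule (CyclicAlgebra K n) X))))⟩
  | succ k ih =>
    intro j hj X hXo hX
    obtain ⟨j, rfl⟩ : ∃ j' : Fin (S.m + 1), j'.val = j := ⟨⟨j, by omega⟩, rfl⟩
    by_cases hPj : P j
    · let G := traceAt K X (S.part j)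
      obtain ⟨t, ht, hq⟩ := ih (j + 1) (by omega) (ModuleCat.of _ (X ⧸ G))
        (hXo.of_surjective (N := ModuleCat.of _ (X ⧸ G)) G.mkQ G.mkQ_surjective) (by
          intro v hv x
          rw [restNat_succ] at hv
          by_cases hvj : v ∈ S.part j
          · exact idem_smul_quotient_traceAt x hvj
          · exact hX.of_surjective (N := ModuleCat.of _ (X ⧸ G)) G.mkQ G.mkQ_surjective v
              (fun h => hv ⟨h, hvj⟩) x)
      have hG : ExtClosure (S.corays K P) (ModuleCat.of (CyclicAlgebra K n) G) :=
        .of _ ⟨j, hPj, coray_iff.2 ⟨hXo.of_injective G.subtype Subtype.val_injective,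
          hX.of_injective G.subtype Subtype.val_injective, isGeneratedAt_traceAt _⟩⟩
      -- The preimage of t is an extension of t by the coray G, and the quotient of X by it is the
      -- quotient of X/G by t.
      refine ⟨t.comap G.mkQ, ?_, ?_⟩
      · refine hG.of_exact ht (Y := ModuleCat.of _ (t.comap G.mkQ))
          (Submodule.inclusion (Submodule.le_comap_mkQ G t))
          (G.mkQ.restrict fun x hx => hx) (Submodule.inclusion_injective _) ?_ ?_
        · rintro ⟨x, hx⟩
          constructor
          · intro h
            exact ⟨⟨x, (Submodule.Quotient.mk_eq_zero G).1 (congrArg Subtype.val h)⟩, rfl⟩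
          · rintro ⟨y, hy⟩
            refine Subtype.ext ((Submodule.Quotient.mk_eq_zero G).2 ?_)
            rw [← hy]
            exact y.2
        · rintro ⟨x, hx⟩
          obtain ⟨y, rfl⟩ := G.mkQ_surjective x
          exact ⟨⟨y, hx⟩, rfl⟩
      · have hsurj : Function.Surjective (t.mkQ.comp G.mkQ) :=
          t.mkQ_surjective.comp G.mkQ_surjective
        have hker : LinearMap.ker (t.mkQ.comp G.mkQ) = t.comap G.mkQ := by
          rw [LinearMap.ker_comp, Submodule.ker_mkQ]
        rw [← hker]
        exact hq.of_linearEquiv (LinearMap.quotKerEquivOfSurjective _ hsurj).symm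
    · let G := rejectAt K X (S.part j)
      obtain ⟨t, ht, hq⟩ := ih (j + 1) (by omega) (ModuleCat.of _ G)
        (hXo.of_injective G.subtype Subtype.val_injective) (by
          intro v hv x
          rw [restNat_succ] at hv
          by_cases hvj : v ∈ S.part j
          · exact Subtype.ext (idem_smul_eq_zero_of_mem_rejectAt x.2 hvj)
          · exact hX.of_injective (N := ModuleCat.of _ G) G.subtype Subtype.val_injective v
              (fun h => hv ⟨h, hvj⟩) x)
      have hG : ExtClosure (S.rays K P') (ModuleCat.of (CyclicAlgebra K n) (X ⧸ G)) :=
        .of _ ⟨j, (hP _).2 hPj, ray_iff.2 ⟨hXo.of_surjective G.mkQ G.mkQ_surjective,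
          hX.of_surjective G.mkQ G.mkQ_surjective, hasSocleAt_quotient_rejectAt _⟩⟩
      have hle : t.map G.subtype ≤ G := Submodule.map_subtype_le G t
      have hmap : t ≤ (t.map G.subtype).comap G.subtype := Submodule.le_comap_map _ _
      -- Here t stays the torsion part, and X/t is an extension of the ray X/G by G/t.
      refine ⟨t.map G.subtype, ?_, ?_⟩
      · exact ht.of_linearEquiv (Submodule.equivMapOfInjective G.subtype Subtype.val_injective t)
      · refine hq.of_exact hG (Y := ModuleCat.of _ (X ⧸ t.map G.subtype))
          (t.mapQ (t.map G.subtype) G.subtype hmap)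
          (Submodule.factor hle) ?_ ?_ ?_
        · rw [← LinearMap.ker_eq_bot, Submodule.ker_mapQ,
            Submodule.comap_map_eq_of_injective Subtype.val_injective, Submodule.mkQ_map_self]
        · rw [LinearMap.exact_iff, Submodule.range_mapQ, Submodule.range_subtype,
            Submodule.factor, Submodule.ker_mapQ, Submodule.comap_id]
        · exact Submodule.factor_surjective hle

end PartTuple

/-- The torsion pair of a complete part partition. -/
noncomputable def PartTuple.torsionPair {K : Type u} [Field K] {n : ℕ} [NeZero n]
    {P P' : ℕ → Prop} (hP : ∀ j, P' j ↔ ¬ P j) (S : PartTuple (CyclicQuiver n))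
    (hS : S.IsComplete) : TorsionPair (IsOrdinary K (CyclicQuiver n)) :=
  TorsionPair.ofExtClosure (P := S.corays K P) (Q := S.rays K P')
    (ExtClosure.le_of_forall (fun _ ⟨_, _, h⟩ => h.1) isOrdinary_of_isZero isOrdinary_of_shortExact)
    (ExtClosure.le_of_forall (fun _ ⟨_, _, h⟩ => h.1) isOrdinary_of_isZero isOrdinary_of_shortExact)
    (fun _ _ hX hY f => S.hom_eq_zero_of_corays_of_rays hP hX hY f)
    (fun X hX => hS.exists_submodule hP (S.m + 1) 0 (by omega) X hX
      fun _ hv => absurd (fun _ hi => absurd hi (Nat.not_lt_zero _)) hv)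

/-! ### Rays and corays in torsion classes -/

namespace TorsionPair

variable {K : Type u} [Field K] {n : ℕ} [NeZero n]
  {p : TorsionPair (IsOrdinary K (CyclicQuiver n))}

lemma T_of_surjective' {X Y : ModuleCat.{u} (CyclicAlgebra K n)} (hX : p.T X)
    (f : X →ₗ[CyclicAlgebra K n] Y) (hf : Function.Surjective f) : p.T Y :=
  T_of_surjective hX ((p.le_T X hX).of_surjective f hf) f hf

lemma F_of_injective' {X Y : ModuleCat.{u} (CyclicAlgebra K n)} (hY : p.F Y)
    (f : X →ₗ[CyclicAlgebra K n] Y) (hf : Function.Injective f) : p.F X :=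
  F_of_injective hY ((p.le_F Y hY).of_injective f hf) f hf

/-- An element at v generates a coray at v inside M, which is torsion even if M is not. -/
lemma apply_eq_zero_of_coray_le {R : Set (CyclicQuiver n)} {v : CyclicQuiver n}
    (h : Coray R {v} ≤ p.T) {M Z : ModuleCat.{u} (CyclicAlgebra K n)}
    (hMo : IsOrdinary K (CyclicQuiver n) M) (hMs : IsSupportedOn R M) (hZ : p.F Z)
    (g : M →ₗ[CyclicAlgebra K n] Z) {x : M} (hx : idem K v • x = x) : g x = 0 := by
  let N := Submodule.span (CyclicAlgebra K n) {x}
  have hx' : x ∈ N := Submodule.mem_span_singleton_self x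
  have hN : Coray R {v} (ModuleCat.of (CyclicAlgebra K n) N) := by
    refine coray_iff.2 ⟨hMo.of_injective N.subtype Subtype.val_injective,
      hMs.of_injective N.subtype Subtype.val_injective, top_le_iff.1 ?_⟩
    rintro ⟨z, hz⟩ -
    obtain ⟨r, rfl⟩ := Submodule.mem_span_singleton.1 hz
    exact Submodule.smul_mem _ r
      (Submodule.subset_span (s := {y : N | ∃ w ∈ ({v} : Set _), idem K w • y = y})
        (show (⟨x, hx'⟩ : N) ∈ _ from ⟨v, rfl, Subtype.ext hx⟩))
  exact LinearMap.congr_fun (hom_eq_zero (h _ hN) hZ (g.comp N.subtype)) ⟨x, hx'⟩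

lemma coray_le_T {R D : Set (CyclicQuiver n)} (h : ∀ v ∈ D, Coray R {v} ≤ p.T) :
    Coray R D ≤ p.T := by
  intro M hM
  obtain ⟨hMo, hMs, hMg⟩ := coray_iff.1 hM
  exact p.T_iff.2 ⟨hMo, fun Z hZ g => hMg.eq_zero g fun v hv x hx =>
    apply_eq_zero_of_coray_le (h v hv) hMo hMs hZ g hx⟩

/-- If a map from a torsion module to M hits a nonzero element, some arrow multiple of it is a
nonzero socle element, which has a component at some v in D. But the image dies in the quotient by
the reject at v, which is a ray at v and hence torsion-free. -/
lemma ray_le_F {R D : Set (CyclicQuiver n)} (h : ∀ v ∈ D, Ray R {v} ≤ p.F) :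
    Ray R D ≤ p.F := by
  intro M hM
  obtain ⟨hMo, hMs, hMg⟩ := ray_iff.1 hM
  refine p.F_iff.2 ⟨hMo, fun X hX g => LinearMap.ext fun x => ?_⟩
  by_contra h0
  have hmem : ∀ v ∈ D, g x ∈ rejectAt K M {v} := by
    intro v hv
    have hq : Ray R {v} (ModuleCat.of (CyclicAlgebra K n) (M ⧸ rejectAt K M {v})) :=
      ray_iff.2 ⟨hMo.of_surjective (rejectAt K M {v}).mkQ (Submodule.mkQ_surjective _),
        hMs.of_surjective (rejectAt K M {v}).mkQ (Submodule.mkQ_surjective _),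
        hasSocleAt_quotient_rejectAt _⟩
    exact (Submodule.Quotient.mk_eq_zero _).1 (LinearMap.congr_fun
      (hom_eq_zero hX (h v hv _ hq) ((rejectAt K M {v}).mkQ.comp g)) x)
  obtain ⟨k, hk, hk'⟩ := hMo.isArrowNilpotent.exists_pow_smul (x := g x) h0
  apply hk
  rw [← sum_idem_smul (K := K) (V := CyclicQuiver n) (arrowSum K n ^ k • g x)]
  refine Finset.sum_eq_zero fun v _ => ?_
  by_cases hv : v ∈ D
  · exact hmem v hv _ v rfl
  · exact hMg _ (by rw [smul_smul, ← pow_succ', hk']) v hv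

/-- Here R is what a torsion step leaves of R'. A nonzero map from T to a ray at v yields a torsion
uniserial Y from some u in R to v. It is then shown that all corays over R' at u are torsion, so
that u should have been removed. -/
lemma ray_le_F_of_sink {R R' : Set (CyclicQuiver n)}
    (hR : ∀ w, w ∈ R ↔ w ∈ R' ∧ ¬ Coray R' {w} ≤ p.T) {v : CyclicQuiver n}
    (hv : succPerm n v ∉ R) : Ray R {v} ≤ p.F := by
  intro M hM
  obtain ⟨hMo, hMs, hMg⟩ := ray_iff.1 hM
  refine p.F_iff.2 ⟨hMo, fun X hX g => ?_⟩
  by_contra hg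
  obtain ⟨Y, π, hπ, hYs, u, l, y, hy, hu⟩ :=
    exists_isChain_quotient (p.le_T X hX) hMs hMg hg
  have hY := T_of_surjective' hX π hπ
  refine ((hR u).1 (hy.iterate_mem hYs (Nat.zero_le l))).2 fun N hN => ?_
  obtain ⟨hNo, hNs, hNg⟩ := coray_iff.1 hN
  refine p.T_iff.2 ⟨hNo, fun Z hZ g' => hNg.eq_zero g' ?_⟩
  rintro _ rfl x hx
  have hx' : idem K (succPerm n v) • arrowSum K n ^ (l + 1) • x = arrowSum K n ^ (l + 1) • x := by
    rw [← hu, ← Function.iterate_succ_apply' (succPerm n)]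
    exact idem_smul_pow_smul hx (l + 1)
  -- One step past the path from u to v lies the successor of v, which is not in R: either it is
  -- outside R', or its corays over R' are torsion. In both cases g' kills this element, so g' x is
  -- the image of the generator of Y and vanishes.
  have h0 : g' (arrowSum K n ^ (l + 1) • x) = 0 := by
    by_cases hmem : succPerm n v ∈ R'
    · refine apply_eq_zero_of_coray_le ?_ hNo hNs hZ g' hx'
      by_contra h
      exact hv ((hR _).2 ⟨hmem, h⟩)
    · rw [← hx', hNs _ hmem, map_zero]
  obtain ⟨f, hf⟩ := hy.exists_hom (x := g' x) (by rw [← map_smul, hx]) (by rw [← map_smul, h0])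
  rw [← hf, hom_eq_zero hY hZ f, LinearMap.zero_apply]

/-- Here R is what a torsion-free step leaves of R'. A nonzero map from a coray at v to F yields a
torsion-free uniserial N of length l+1 from v to some vertex w of R. As w was not removed, a
contradiction follows once all rays over R' at w are torsion-free; a failure gives a torsion
uniserial Z over R', of length k+1, ending at w. -/
lemma coray_le_T_of_source {R R' : Set (CyclicQuiver n)}
    (hR : ∀ w, w ∈ R ↔ w ∈ R' ∧ ¬ Ray R' {w} ≤ p.F) {v : CyclicQuiver n}
    (hv : ∀ w, succPerm n w = v → w ∉ R) : Coray R {v} ≤ p.T := by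
  intro M hM
  obtain ⟨hMo, hMs, hMg⟩ := coray_iff.1 hM
  refine p.T_iff.2 ⟨hMo, fun X hX f => hMg.eq_zero f ?_⟩
  rintro _ rfl x hx
  by_contra h0
  let N := Submodule.span (CyclicAlgebra K n) {f x}
  obtain ⟨l, hy⟩ := isChain_span_singleton (p.le_F X hX).isArrowNilpotent
    (show idem K _ • f x = f x by rw [← map_smul, hx]) h0
  have hY : p.F (ModuleCat.of (CyclicAlgebra K n) N) :=
    F_of_injective' hX N.subtype Subtype.val_injective
  have hYs : IsSupportedOn R (ModuleCat.of (CyclicAlgebra K n) N) := by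
    rintro w hw ⟨z, hz⟩
    obtain ⟨r, rfl⟩ := Submodule.mem_span_singleton.1 hz
    refine Subtype.ext ?_
    change idem K w • r • f x = 0
    rw [← map_smul, ← map_smul, hMs w hw, map_zero]
  refine ((hR _).1 (IsChain.iterate_mem (M := ModuleCat.of _ N) hy hYs le_rfl)).2 fun L hL => ?_
  obtain ⟨hLo, hLs, hLg⟩ := ray_iff.1 hL
  refine p.F_iff.2 ⟨hLo, fun X' hX' g => ?_⟩
  by_contra hg
  obtain ⟨Z, π, hπ, hZs, u, k, z, hz, huk⟩ :=
    exists_isChain_quotient (p.le_T X' hX') hLs hLg hg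
  have hZ := T_of_surjective' hX' π hπ
  -- If Z is no longer than N, it maps nontrivially to N, which is impossible. If it is longer, it
  -- passes through the predecessor of v, and cutting it off there gives a torsion quotient which is
  -- a ray at a vertex outside R, hence also torsion-free.
  rcases le_or_gt k l with hkl | hkl
  · obtain ⟨d, rfl⟩ := Nat.exists_eq_add_of_le hkl
    rw [Function.iterate_add_apply] at huk
    obtain rfl := (succPerm n).injective.iterate k huk
    obtain ⟨e, he⟩ := hz.exists_hom (idem_smul_pow_smul hy.idem_smul d)
      (by rw [smul_smul, ← pow_add, hy.pow_smul_eq_zero (by omega)])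
    rw [hom_eq_zero (Y := ModuleCat.of _ N) hZ hY e, LinearMap.zero_apply] at he
    exact hy.pow_smul_ne_zero (by omega) he.symm
  · obtain ⟨d, rfl⟩ := Nat.exists_eq_add_of_lt hkl
    rw [add_assoc, Function.iterate_add_apply] at huk
    have hud := (succPerm n).injective.iterate l huk
    rw [Function.iterate_succ_apply'] at hud
    -- Since k = l + d + 1, the generator of B sits at v, and Z/B ends at the predecessor of v.
    let B := Submodule.span (CyclicAlgebra K n) {arrowSum K n ^ (d + 1) • z}
    have hc : IsChain K u d (B.mkQ z) := by
      refine ⟨by rw [← map_smul, hz.idem_smul], fun h => ?_, ?_, ?_⟩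
      · rw [← map_smul] at h
        obtain ⟨r, hr⟩ := Submodule.mem_span_singleton.1 ((Submodule.Quotient.mk_eq_zero _).1 h)
        obtain ⟨q, -, hq⟩ := exists_aeval_smul (X := Z) r ((succPerm n)^[d + 1] u)
        rw [hq _ (idem_smul_pow_smul hz.idem_smul _)] at hr
        apply hz.ne_zero
        have hpow : arrowSum K n ^ (l + d + 1) • z = arrowSum K n ^ (l + 1) • arrowSum K n ^ d • z := by
          rw [smul_smul, ← pow_add]
          congr 2
          omega
        have hcomm : arrowSum K n ^ (l + 1) * Polynomial.aeval (arrowSum K n) q =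
            Polynomial.aeval (arrowSum K n) q * arrowSum K n ^ (l + 1) := by
          simpa using congrArg (Polynomial.aeval (arrowSum K n)) (mul_comm (Polynomial.X ^ (l + 1)) q)
        rw [hpow, ← hr, smul_smul, hcomm, mul_smul, smul_smul (arrowSum K n ^ (l + 1)), ← pow_add, hz.pow_smul_eq_zero (by omega), smul_zero]
      · rw [← map_smul]
        exact (Submodule.Quotient.mk_eq_zero _).2 (Submodule.mem_span_singleton_self _)
      · rw [← Set.image_singleton, Submodule.span_image, hz.span_eq_top, Submodule.map_top,
          Submodule.range_mkQ]
    have hQ : p.T (ModuleCat.of (CyclicAlgebra K n) (Z ⧸ B)) :=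
      T_of_surjective' hZ B.mkQ B.mkQ_surjective
    have hQs : IsSupportedOn R' (ModuleCat.of (CyclicAlgebra K n) (Z ⧸ B)) :=
      hZs.of_surjective B.mkQ B.mkQ_surjective
    have hmem : (succPerm n)^[d] u ∈ R' :=
      IsChain.iterate_mem (M := ModuleCat.of _ (Z ⧸ B)) hc hQs le_rfl
    have hle : Ray R' {(succPerm n)^[d] u} ≤ p.F := by
      by_contra h
      exact hv _ hud ((hR _).2 ⟨hmem, h⟩)
    have hQF := hle (ModuleCat.of (CyclicAlgebra K n) (Z ⧸ B))
      (ray_iff.2 ⟨p.le_T _ hQ, hQs, hc.hasSocleAt⟩)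
    have h1 := LinearMap.congr_fun (hom_eq_zero hQ hQF LinearMap.id) (B.mkQ z)
    rw [LinearMap.id_apply, LinearMap.zero_apply] at h1
    exact hc.ne_zero (by rw [h1, smul_zero])

/-! ### Infinite families of uniserial modules -/

-- The indecomposables with top at v are uniserial, one for each length, so infinitely many of them
-- means arbitrarily long ones. A sufficiently long one maps onto any given cyclic module generated
-- at v, so elements at v die in every torsion-free module.
open scoped ModuleCat in
lemma mem_leftVertices_iff {v : CyclicQuiver n} :
    v ∈ leftVertices p.T ↔ Coray Set.univ {v} ≤ p.T := by
  constructor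
  · intro hv
    have hlong : ∀ L : ℕ, ∃ (M : ModuleCat.{u} (CyclicAlgebra K n)) (l : ℕ) (y : M),
        L ≤ l ∧ p.T M ∧ IsChain K v l y := by
      intro L
      by_contra! h
      refine hv (Set.Finite.subset (Set.Finite.biUnion (Set.finite_lt_nat L)
        (t := fun l => {c | ∃ (M : ModuleCat.{u} (CyclicAlgebra K n)) (y : M),
          c = ⟦M⟧ ∧ IsChain K v l y}) fun l _ => Set.Subsingleton.finite ?_) ?_)
      · rintro _ ⟨M, y, rfl, hy⟩ _ ⟨N, z, rfl, hz⟩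
        obtain ⟨e⟩ := hy.nonempty_linearEquiv hz
        exact Quotient.sound ⟨e.toModuleIso⟩
      · rintro _ ⟨M, rfl, hM, -, ⟨e⟩⟩
        have := (p.le_T M hM).1
        obtain ⟨l, y, hy⟩ := exists_isChain_of_topQuotient (p.le_T M hM).isArrowNilpotent e
        refine Set.mem_biUnion (x := l) ?_ ⟨M, y, rfl, hy⟩
        by_contra hl
        exact h M l y (not_lt.1 hl) hM hy
    intro M hM
    obtain ⟨hMo, -, hMg⟩ := coray_iff.1 hM
    refine p.T_iff.2 ⟨hMo, fun Z hZ g => hMg.eq_zero g ?_⟩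
    rintro _ rfl x hx
    obtain ⟨N, hN⟩ := hMo.isArrowNilpotent
    obtain ⟨Y, l, y, hl, hY, hy⟩ := hlong N
    obtain ⟨f, hf⟩ := hy.exists_hom (x := g x) (by rw [← map_smul, hx]) (by
      rw [← map_smul, pow_smul_eq_zero_of_le (Nat.le_succ_of_le hl) (hN x), map_zero])
    rw [← hf, hom_eq_zero hY hZ f, LinearMap.zero_apply]
  · intro hv
    choose X y hy using fun l => exists_isChain K v l
    refine Set.infinite_of_injective_forall_mem (f := fun l => ⟦X l⟧) (fun l k h => ?_) fun l =>
      ⟨X l, rfl, hv _ (coray_iff.2 ⟨(hy l).isOrdinary, fun w hw => absurd trivial hw,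
        (hy l).isGeneratedAt⟩), (hy l).indecomposable, (hy l).nonempty_topQuotient⟩
    obtain ⟨e⟩ := Quotient.exact h
    exact le_antisymm
      ((hy l).length_le_of_injective (hy k) e.toLinearEquiv.toLinearMap e.toLinearEquiv.injective)
      ((hy k).length_le_of_injective (hy l) e.symm.toLinearEquiv.toLinearMap
        e.symm.toLinearEquiv.injective)

-- Dual argument: a torsion uniserial ending at v would map nontrivially to a longer torsion-free
-- uniserial ending at v.
open scoped ModuleCat in
lemma mem_rightVertices_iff {v : CyclicQuiver n} :
    v ∈ rightVertices p.F ↔ Ray Set.univ {v} ≤ p.F := by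
  constructor
  · intro hv
    have hlong : ∀ L : ℕ, ∃ (M : ModuleCat.{u} (CyclicAlgebra K n)) (u : CyclicQuiver n) (l : ℕ)
        (y : M), L ≤ l ∧ p.F M ∧ IsChain K u l y ∧ (succPerm n)^[l] u = v := by
      intro L
      by_contra! h
      refine hv (Set.Finite.subset (Set.Finite.biUnion (Set.finite_lt_nat L)
        (t := fun l => {c | ∃ (M : ModuleCat.{u} (CyclicAlgebra K n)) (u : CyclicQuiver n) (y : M),
          c = ⟦M⟧ ∧ IsChain K u l y ∧ (succPerm n)^[l] u = v})
        fun l _ => Set.Subsingleton.finite ?_) ?_)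
      · rintro _ ⟨M, u, y, rfl, hy, hu⟩ _ ⟨N, w, z, rfl, hz, hw⟩
        obtain rfl := (succPerm n).injective.iterate l (hu.trans hw.symm)
        obtain ⟨e⟩ := hy.nonempty_linearEquiv hz
        exact Quotient.sound ⟨e.toModuleIso⟩
      · rintro _ ⟨M, rfl, hM, -, ⟨e⟩⟩
        obtain ⟨u, l, y, hy, hu⟩ := exists_isChain_of_socle (p.le_F M hM).isArrowNilpotent e
        refine Set.mem_biUnion (x := l) ?_ ⟨M, u, y, rfl, hy, hu⟩
        by_contra hl
        exact h M u l y (not_lt.1 hl) hM hy hu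
    intro M hM
    obtain ⟨hMo, hMs, hMg⟩ := ray_iff.1 hM
    refine p.F_iff.2 ⟨hMo, fun X hX g => ?_⟩
    by_contra hg
    obtain ⟨Y, π, hπ, -, u, l, y, hy, hu⟩ :=
      exists_isChain_quotient (p.le_T X hX) hMs hMg hg
    obtain ⟨N, w, k, z, hlk, hN, hz, hw⟩ := hlong l
    obtain ⟨d, rfl⟩ := Nat.exists_eq_add_of_le hlk
    rw [Function.iterate_add_apply, ← hu] at hw
    obtain rfl := (succPerm n).injective.iterate l hw
    obtain ⟨f, hf⟩ := hy.exists_hom (idem_smul_pow_smul hz.idem_smul d)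
      (by rw [smul_smul, ← pow_add, hz.pow_smul_eq_zero (by omega)])
    rw [hom_eq_zero (T_of_surjective' hX π hπ) hN f, LinearMap.zero_apply] at hf
    exact hz.pow_smul_ne_zero (by omega) hf.symm
  · intro hv
    choose u hu using fun l => (succPerm n).surjective.iterate l v
    choose X y hy using fun l => exists_isChain K (u l) l
    refine Set.infinite_of_injective_forall_mem (f := fun l => ⟦X l⟧) (fun l k h => ?_) fun l =>
      ⟨X l, rfl, hv _ (ray_iff.2 ⟨(hy l).isOrdinary, fun w hw => absurd trivial hw,
        hu l ▸ (hy l).hasSocleAt⟩), (hy l).indecomposable, by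
          have := (hy l).nonempty_socle
          rwa [hu] at this⟩
    obtain ⟨e⟩ := Quotient.exact h
    exact le_antisymm
      ((hy l).length_le_of_injective (hy k) e.toLinearEquiv.toLinearMap e.toLinearEquiv.injective)
      ((hy k).length_le_of_injective (hy l) e.symm.toLinearEquiv.toLinearMap
        e.symm.toLinearEquiv.injective)

end TorsionPair

/-! ### The part partition of a torsion pair -/

section Paths

variable {n : ℕ} [NeZero n]

/-- Walking forward from v must leave R because the cycle passes through w; the last vertex before
leaving is a sink. -/
lemma exists_path_to_sink {R : Set (CyclicQuiver n)} {w : CyclicQuiver n} (hw : w ∉ R)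
    {v : CyclicQuiver n} (hv : v ∈ R) :
    ∃ l : ℕ, (∀ i ≤ l, (succPerm n)^[i] v ∈ R) ∧ IsSinkIn R ((succPerm n)^[l] v) := by
  classical
  have hex : ∃ k, (succPerm n)^[k] v ∉ R := by
    obtain ⟨k, hk⟩ := exists_iterate_eq v w
    exact ⟨k, hk ▸ hw⟩
  have h0 : Nat.find hex ≠ 0 := fun h => by
    have := Nat.find_spec hex
    rw [h] at this
    exact this hv
  obtain ⟨l, hl⟩ := Nat.exists_eq_succ_of_ne_zero h0
  have hmem : ∀ i ≤ l, (succPerm n)^[i] v ∈ R := fun i hi =>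
    not_not.1 (Nat.find_min hex (by omega))
  refine ⟨l, hmem, hmem l le_rfl, fun x hx => isEmpty_hom_iff.2 ?_⟩
  rintro rfl
  have := Nat.find_spec hex
  rw [hl, Function.iterate_succ_apply'] at this
  exact this hx

lemma exists_path_from_source {R : Set (CyclicQuiver n)} {w : CyclicQuiver n} (hw : w ∉ R)
    {v : CyclicQuiver n} (hv : v ∈ R) :
    ∃ (l : ℕ) (u : CyclicQuiver n), (succPerm n)^[l] u = v ∧
      (∀ i ≤ l, (succPerm n)^[i] u ∈ R) ∧ IsSourceIn R u := by
  by_contra! h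
  -- Without a source, the backward walk from v never leaves R, yet it reaches w.
  have key : ∀ l : ℕ, ∀ u, (succPerm n)^[l] u = v → ∀ i ≤ l, (succPerm n)^[i] u ∈ R := by
    intro l
    induction l with
    | zero =>
      rintro u rfl i hi
      obtain rfl : i = 0 := by omega
      exact hv
    | succ l ih =>
      intro u hu i hi
      have h1 := ih (succPerm n u) hu
      rcases i with _ | i
      · by_contra hnot
        refine h l _ hu h1 ⟨h1 0 (Nat.zero_le _), fun x hx => isEmpty_hom_iff.2 fun hxu => hnot ?_⟩
        exact (succPerm n).injective hxu ▸ hx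
      · exact h1 i (by omega)
  obtain ⟨l, hl⟩ := exists_iterate_eq w v
  exact hw (key l w hl 0 (Nat.zero_le _))

end Paths

/-- For every `j ≥ 1` with `P' j`, respectively `P j`, the part `Δ_j` contains all sinks,
respectively all sources, of the full subquiver on the remaining vertices. -/
def PartTuple.IsStrong {V : Type} [Quiver.{0} V] (P P' : ℕ → Prop) (S : PartTuple V) : Prop :=
  ∀ j : Fin (S.m + 1), j ≠ 0 →
    (P' j.val → ∀ v, IsSinkIn (S.rest j) v → v ∈ S.part j) ∧
    (P j.val → ∀ v, IsSourceIn (S.rest j) v → v ∈ S.part j)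

namespace TorsionPair

variable {K : Type u} [Field K] {n : ℕ} [NeZero n]

/-- The vertices `v` in `R` such that all corays (respectively rays) at `v` supported on `R` belong
to the torsion class (respectively the torsion-free class). -/
def partIn (p : TorsionPair (IsOrdinary K (CyclicQuiver n))) (isT : Prop)
    (R : Set (CyclicQuiver n)) : Set (CyclicQuiver n) :=
  {v ∈ R | (isT → Coray R {v} ≤ p.T) ∧ (¬ isT → Ray R {v} ≤ p.F)}

/-- The vertices remaining after `j` steps. -/
def restSeq (p : TorsionPair (IsOrdinary K (CyclicQuiver n))) (P : ℕ → Prop) :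
    ℕ → Set (CyclicQuiver n)
  | 0 => Set.univ
  | j + 1 => p.restSeq P j \ p.partIn (P j) (p.restSeq P j)

variable {p : TorsionPair (IsOrdinary K (CyclicQuiver n))} {P P' : ℕ → Prop}

lemma mem_partIn_of_pos {isT : Prop} (h : isT) {R : Set (CyclicQuiver n)} {v : CyclicQuiver n} :
    v ∈ p.partIn isT R ↔ v ∈ R ∧ Coray R {v} ≤ p.T := by
  simp [partIn, h]

lemma mem_partIn_of_neg {isT : Prop} (h : ¬ isT) {R : Set (CyclicQuiver n)} {v : CyclicQuiver n} :
    v ∈ p.partIn isT R ↔ v ∈ R ∧ Ray R {v} ≤ p.F := by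
  simp [partIn, h]

lemma mem_restSeq_succ_of_pos {j : ℕ} (h : P j) {v : CyclicQuiver n} :
    v ∈ p.restSeq P (j + 1) ↔ v ∈ p.restSeq P j ∧ ¬ Coray (p.restSeq P j) {v} ≤ p.T := by
  rw [restSeq, Set.mem_sdiff, mem_partIn_of_pos h]
  tauto

lemma mem_restSeq_succ_of_neg {j : ℕ} (h : ¬ P j) {v : CyclicQuiver n} :
    v ∈ p.restSeq P (j + 1) ↔ v ∈ p.restSeq P j ∧ ¬ Ray (p.restSeq P j) {v} ≤ p.F := by
  rw [restSeq, Set.mem_sdiff, mem_partIn_of_neg h]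
  tauto

lemma restSeq_antitone : Antitone (p.restSeq P) :=
  antitone_nat_of_succ_le fun _ => Set.sdiff_subset

lemma mem_partIn_of_isSinkIn (hP : ∀ j, P (j + 1) ↔ ¬ P j) {j : ℕ} (hj : ¬ P (j + 1))
    {v : CyclicQuiver n} (hv : IsSinkIn (p.restSeq P (j + 1)) v) :
    v ∈ p.partIn (P (j + 1)) (p.restSeq P (j + 1)) := by
  rw [mem_partIn_of_neg hj]
  have hj' : P j := by
    rw [hP] at hj
    exact not_not.1 hj
  exact ⟨hv.1, ray_le_F_of_sink (fun w => mem_restSeq_succ_of_pos hj')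
    fun h => (hv.2 _ h).elim (arrowFrom v)⟩

lemma mem_partIn_of_isSourceIn (hP : ∀ j, P (j + 1) ↔ ¬ P j) {j : ℕ} (hj : P (j + 1))
    {v : CyclicQuiver n} (hv : IsSourceIn (p.restSeq P (j + 1)) v) :
    v ∈ p.partIn (P (j + 1)) (p.restSeq P (j + 1)) := by
  rw [mem_partIn_of_pos hj]
  refine ⟨hv.1, coray_le_T_of_source (fun w => mem_restSeq_succ_of_neg ((hP j).1 hj)) ?_⟩
  rintro w rfl h
  exact (hv.2 _ h).elim (arrowFrom w)

/-- From step one on the remainder is a proper subset of the cycle, so it has a sink and a source,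
and these belong to the next part. -/
lemma partIn_nonempty (hP : ∀ j, P (j + 1) ↔ ¬ P j) (h0 : (p.partIn (P 0) Set.univ).Nonempty)
    {j : ℕ} (hj : (p.restSeq P j).Nonempty) : (p.partIn (P j) (p.restSeq P j)).Nonempty := by
  cases j with
  | zero => exact h0
  | succ j =>
    obtain ⟨w, hw⟩ := h0
    obtain ⟨v, hv⟩ := hj
    have hw' : w ∉ p.restSeq P (j + 1) := fun h =>
      (restSeq_antitone (Nat.succ_le_succ (Nat.zero_le j)) h : w ∈ p.restSeq P 1).2 hw
    by_cases hj : P (j + 1)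
    · obtain ⟨l, u, -, -, hu⟩ := exists_path_from_source hw' hv
      exact ⟨u, mem_partIn_of_isSourceIn hP hj hu⟩
    · obtain ⟨l, -, hu⟩ := exists_path_to_sink hw' hv
      exact ⟨_, mem_partIn_of_isSinkIn hP hj hu⟩

lemma exists_restSeq_eq_empty (hP : ∀ j, P (j + 1) ↔ ¬ P j)
    (h0 : (p.partIn (P 0) Set.univ).Nonempty) : ∃ m, p.restSeq P (m + 1) = ∅ := by
  by_contra! h
  have key : ∀ j, (p.restSeq P j).ncard + j ≤ Fintype.card (CyclicQuiver n) := by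
    intro j
    induction j with
    | zero => rw [restSeq, Set.ncard_univ, Nat.card_eq_fintype_card, add_zero]
    | succ j ih =>
      have hne : (p.restSeq P j).Nonempty := (h j).mono Set.sdiff_subset
      obtain ⟨v, hv⟩ := partIn_nonempty hP h0 hne
      have hlt : (p.restSeq P (j + 1)).ncard < (p.restSeq P j).ncard :=
        Set.ncard_lt_ncard ⟨Set.sdiff_subset, fun hle => (hle hv.1).2 hv⟩ (Set.toFinite _)
      omega
  have := key (Fintype.card (CyclicQuiver n) + 1)
  omega

/-- The part partition of a torsion pair. -/
noncomputable def partTuple (p : TorsionPair (IsOrdinary K (CyclicQuiver n)))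
    (hP : ∀ j, P (j + 1) ↔ ¬ P j) (h0 : (p.partIn (P 0) Set.univ).Nonempty) :
    PartTuple (CyclicQuiver n) where
  -- The least index after which nothing remains; minimality makes the parts up to m nonempty. The
  -- set is nonempty by `exists_restSeq_eq_empty`, so the default value of `sInf` plays no role.
  m := sInf {m | p.restSeq P (m + 1) = ∅}
  part i := p.partIn (P i) (p.restSeq P i)
  disjoint i j hij := by
    wlog h : i < j generalizing i j
    · exact (this j i hij.symm (lt_of_le_of_ne (not_lt.1 h) hij.symm)).symm
    · refine Set.disjoint_left.2 fun v hi hj => ?_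
      exact (restSeq_antitone (Nat.succ_le_of_lt h) hj.1 : v ∈ p.restSeq P (i.val + 1)).2 hi
  nonempty i hi := by
    refine partIn_nonempty hP h0 (Set.nonempty_iff_ne_empty.2 fun h => ?_)
    obtain ⟨k, hk⟩ := Nat.exists_eq_succ_of_ne_zero (Fin.val_ne_zero_iff.2 hi)
    rw [hk] at h
    have : sInf {m | p.restSeq P (m + 1) = ∅} ≤ k := Nat.sInf_le h
    have := i.isLt
    omega

lemma partTuple_restNat (hP : ∀ j, P (j + 1) ↔ ¬ P j)
    (h0 : (p.partIn (P 0) Set.univ).Nonempty) (j : ℕ) (hj : j ≤ (p.partTuple hP h0).m + 1) :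
    (p.partTuple hP h0).restNat j = p.restSeq P j := by
  induction j with
  | zero => exact Set.eq_univ_of_forall fun v i hi => absurd hi (Nat.not_lt_zero _)
  | succ j ih =>
    have := (p.partTuple hP h0).restNat_succ ⟨j, hj⟩
    rw [ih (by omega)] at this
    exact this

lemma partTuple_isComplete (hP : ∀ j, P (j + 1) ↔ ¬ P j)
    (h0 : (p.partIn (P 0) Set.univ).Nonempty) : (p.partTuple hP h0).IsComplete := by
  intro v
  by_contra! h
  have hm : p.restSeq P ((p.partTuple hP h0).m + 1) = ∅ :=
    Nat.sInf_mem (s := {m | p.restSeq P (m + 1) = ∅}) (exists_restSeq_eq_empty hP h0)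
  rw [← partTuple_restNat hP h0 _ le_rfl] at hm
  exact Set.notMem_empty v (hm ▸ fun i _ => h i)

lemma partTuple_isStrong (hP : ∀ j, P (j + 1) ↔ ¬ P j) (hP' : ∀ j, P' j ↔ ¬ P j)
    (h0 : (p.partIn (P 0) Set.univ).Nonempty) : (p.partTuple hP h0).IsStrong P P' := by
  rintro ⟨j, hj⟩ hj0
  obtain ⟨k, rfl⟩ := Nat.exists_eq_succ_of_ne_zero (fun h => hj0 (Fin.ext h))
  have hrest : (p.partTuple hP h0).rest ⟨k + 1, hj⟩ = p.restSeq P (k + 1) :=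
    partTuple_restNat hP h0 (k + 1) hj.le
  rw [hrest]
  exact ⟨fun h v hv => mem_partIn_of_isSinkIn hP ((hP' _).1 h) hv,
    fun h v hv => mem_partIn_of_isSourceIn hP h hv⟩

lemma corays_partTuple_le (hP : ∀ j, P (j + 1) ↔ ¬ P j)
    (h0 : (p.partIn (P 0) Set.univ).Nonempty) : (p.partTuple hP h0).corays K P ≤ p.T := by
  rintro M ⟨j, hj, hM⟩
  have hrest : (p.partTuple hP h0).rest j = p.restSeq P j := partTuple_restNat hP h0 j j.isLt.le
  rw [hrest] at hM
  exact coray_le_T (fun v hv => ((mem_partIn_of_pos hj).1 hv).2) M hM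

lemma rays_partTuple_le (hP : ∀ j, P (j + 1) ↔ ¬ P j) (hP' : ∀ j, P' j ↔ ¬ P j)
    (h0 : (p.partIn (P 0) Set.univ).Nonempty) : (p.partTuple hP h0).rays K P' ≤ p.F := by
  rintro M ⟨j, hj, hM⟩
  have hrest : (p.partTuple hP h0).rest j = p.restSeq P j := partTuple_restNat hP h0 j j.isLt.le
  rw [hrest] at hM
  exact ray_le_F (fun v hv => ((mem_partIn_of_neg ((hP' _).1 hj)).1 hv).2) M hM

lemma eq_extClosure_of_le (hP' : ∀ j, P' j ↔ ¬ P j) {S : PartTuple (CyclicQuiver n)}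
    (hS : S.IsComplete) (hT : S.corays K P ≤ p.T) (hF : S.rays K P' ≤ p.F) :
    p.T = ExtClosure (S.corays K P) ∧ p.F = ExtClosure (S.rays K P') :=
  eq_extClosure (extClosure_le_T isOrdinary_of_isZero isOrdinary_of_shortExact hT)
    (extClosure_le_F isOrdinary_of_isZero isOrdinary_of_shortExact hF)
    fun X hX => hS.exists_submodule hP' (S.m + 1) 0 (by omega) X hX
      fun _ hv => absurd (fun _ hi => absurd hi (Nat.not_lt_zero _)) hv

/-! ### Uniqueness of the part partition -/

/-- A vertex v of the greedy part that is missing from Δ_j survives to the next remainder. There it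
is joined by a path to a sink, or from a source, which lies in the next part by strongness. The
uniserial module on this path is in T and in F. -/
lemma part_eq_partIn (hP : ∀ j, P (j + 1) ↔ ¬ P j) (hP' : ∀ j, P' j ↔ ¬ P j)
    {S : PartTuple (CyclicQuiver n)} (hS : S.IsComplete) (hs : S.IsStrong P P')
    (h0 : (S.part 0).Nonempty) (hT : S.corays K P ≤ p.T) (hF : S.rays K P' ≤ p.F)
    (j : Fin (S.m + 1)) : S.part j = p.partIn (P j) (S.rest j) := by
  apply subset_antisymm
  · intro v hv
    have hle : ({v} : Set (CyclicQuiver n)) ⊆ S.part j := Set.singleton_subset_iff.2 hv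
    have hsub := S.part_subset_restNat j hv
    by_cases hj : P j
    · rw [mem_partIn_of_pos hj]
      refine ⟨hsub, fun M hM => hT M ⟨j, hj, ?_⟩⟩
      obtain ⟨h1, h2, h3⟩ := coray_iff.1 hM
      refine coray_iff.2 ⟨h1, h2, top_le_iff.1 (h3.ge.trans (Submodule.span_mono ?_))⟩
      rintro x ⟨w, hw, hx⟩
      exact ⟨w, hle hw, hx⟩
    · rw [mem_partIn_of_neg hj]
      refine ⟨hsub, fun M hM => hF M ⟨j, (hP' _).2 hj, ?_⟩⟩
      obtain ⟨h1, h2, h3⟩ := ray_iff.1 hM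
      exact ray_iff.2 ⟨h1, h2, fun x hx w hw => h3 x hx w fun h => hw (hle h)⟩
  · intro v hv
    by_contra hvj
    have hvr : v ∈ S.restNat (j + 1) := by
      rw [S.restNat_succ]
      exact ⟨hv.1, hvj⟩
    -- Since v survives Δ_j and the tuple is complete, a next part exists.
    have hjm : j.val + 1 < S.m + 1 := by
      by_contra hlt
      have : j.val + 1 = S.m + 1 := by
        have := j.isLt
        omega
      rw [this, hS.restNat_eq_empty] at hvr
      exact hvr
    let k : Fin (S.m + 1) := ⟨j.val + 1, hjm⟩
    have hk0 : k ≠ 0 := fun h => Nat.succ_ne_zero j.val (congrArg Fin.val h)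
    obtain ⟨w, hw⟩ := h0
    have hwr : w ∉ S.rest k := fun h => h 0 (Fin.pos_iff_ne_zero.2 hk0) hw
    have hsub : S.restNat (j.val + 1) ⊆ S.rest j := fun x hx i hi => hx i (by omega)
    by_cases hj : P j
    · obtain ⟨l, hl, hsink⟩ := exists_path_to_sink hwr hvr
      have hk : P' k := (hP' _).2 fun h => (hP j).1 h hj
      have hmem := (hs k hk0).1 hk _ hsink
      obtain ⟨X, y, hy⟩ := exists_isChain K v l
      have hXT : p.T X := ((mem_partIn_of_pos hj).1 hv).2 X (coray_iff.2
        ⟨hy.isOrdinary, hy.isSupportedOn fun i hi => hsub (hl i hi), hy.isGeneratedAt⟩)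
      have hXF : p.F X := hF X ⟨k, hk, ray_iff.2 ⟨hy.isOrdinary, hy.isSupportedOn hl,
        fun x hx w hw => hy.hasSocleAt x hx w fun h => hw (h ▸ hmem)⟩⟩
      have h1 := LinearMap.congr_fun (hom_eq_zero hXT hXF LinearMap.id) y
      exact hy.ne_zero (by rw [show y = 0 from h1, smul_zero])
    · obtain ⟨l, u, hu, hl, hsource⟩ := exists_path_from_source hwr hvr
      have hk : P k := (hP j).2 hj
      have hmem := (hs k hk0).2 hk _ hsource
      obtain ⟨X, y, hy⟩ := exists_isChain K u l
      have hXF : p.F X := ((mem_partIn_of_neg hj).1 hv).2 X (ray_iff.2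
        ⟨hy.isOrdinary, hy.isSupportedOn fun i hi => hsub (hl i hi), hu ▸ hy.hasSocleAt⟩)
      have hXT : p.T X := hT X ⟨k, hk, coray_iff.2 ⟨hy.isOrdinary, hy.isSupportedOn hl,
        top_le_iff.1 (hy.isGeneratedAt.ge.trans (Submodule.span_mono (by
          rintro x ⟨w, rfl, hx⟩
          exact ⟨w, hmem, hx⟩)))⟩⟩
      have h1 := LinearMap.congr_fun (hom_eq_zero hXT hXF LinearMap.id) y
      exact hy.ne_zero (by rw [show y = 0 from h1, smul_zero])

lemma restNat_eq_restSeq {S : PartTuple (CyclicQuiver n)}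
    (h : ∀ j : Fin (S.m + 1), S.part j = p.partIn (P j) (S.rest j)) (j : ℕ) (hj : j ≤ S.m + 1) :
    S.restNat j = p.restSeq P j := by
  induction j with
  | zero => exact Set.eq_univ_of_forall fun v i hi => absurd hi (Nat.not_lt_zero _)
  | succ j ih =>
    have h1 := S.restNat_succ ⟨j, hj⟩
    have h2 : S.rest ⟨j, hj⟩ = p.restSeq P j := ih (by omega)
    rw [h ⟨j, hj⟩, h2, ih (by omega)] at h1
    exact h1

/-- Both tuples run through the same greedy remainders, so once one is exhausted the other has no
room for a further nonempty part. -/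
lemma m_le_of_part_eq_partIn {S S' : PartTuple (CyclicQuiver n)} (hS' : S'.IsComplete)
    (h : ∀ j : Fin (S.m + 1), S.part j = p.partIn (P j) (S.rest j))
    (h' : ∀ j : Fin (S'.m + 1), S'.part j = p.partIn (P j) (S'.rest j)) : S.m ≤ S'.m := by
  by_contra! hlt
  have hne := S.nonempty ⟨S'.m + 1, by omega⟩ fun h => Nat.succ_ne_zero _ (congrArg Fin.val h)
  obtain ⟨v, hv⟩ := hne
  have h1 := S.part_subset_restNat _ hv
  rw [restNat_eq_restSeq h _ (by omega), ← restNat_eq_restSeq h' _ le_rfl,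
    hS'.restNat_eq_empty] at h1
  exact h1

lemma partTuple_unique {S S' : PartTuple (CyclicQuiver n)} (hS : S.IsComplete)
    (hS' : S'.IsComplete)
    (h : ∀ j : Fin (S.m + 1), S.part j = p.partIn (P j) (S.rest j))
    (h' : ∀ j : Fin (S'.m + 1), S'.part j = p.partIn (P j) (S'.rest j)) : S = S' := by
  have hm := le_antisymm (m_le_of_part_eq_partIn hS' h h') (m_le_of_part_eq_partIn hS h' h)
  have hpart : ∀ (j : ℕ) (hj : j < S.m + 1) (hj' : j < S'.m + 1),
      S.part ⟨j, hj⟩ = S'.part ⟨j, hj'⟩ := by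
    intro j hj hj'
    have h1 : S.rest ⟨j, hj⟩ = p.restSeq P j := restNat_eq_restSeq h j hj.le
    have h2 : S'.rest ⟨j, hj'⟩ = p.restSeq P j := restNat_eq_restSeq h' j hj'.le
    rw [h, h', h1, h2]
  obtain ⟨m, part, hd, hn⟩ := S
  obtain ⟨m', part', hd', hn'⟩ := S'
  obtain rfl : m = m' := hm
  obtain rfl : part = part' := funext fun j => hpart j j.isLt j.isLt
  rfl

/-- Torsion pairs correspond to complete strong part partitions. -/
theorem exists_equiv_partTuple (hP : ∀ j, P (j + 1) ↔ ¬ P j) (hP' : ∀ j, P' j ↔ ¬ P j)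
    (L : TorsionPair (IsOrdinary K (CyclicQuiver n)) → Set (CyclicQuiver n))
    (hL : ∀ p, L p = p.partIn (P 0) Set.univ) (Q : PartTuple (CyclicQuiver n) → Prop)
    (hQ : ∀ S, Q S ↔ S.IsStrong P P') :
    ∃ Φ : {p : TorsionPair (IsOrdinary K (CyclicQuiver n)) // (L p).Nonempty} ≃
        {S : PartTuple (CyclicQuiver n) // S.IsComplete ∧ Q S ∧ (S.part 0).Nonempty},
      ∀ p, (Φ p).1.part 0 = L p.1 ∧ p.1.T = ExtClosure ((Φ p).1.corays K P) ∧
        p.1.F = ExtClosure ((Φ p).1.rays K P') := by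
  have h0 : ∀ p : {p : TorsionPair (IsOrdinary K (CyclicQuiver n)) // (L p).Nonempty},
      (p.1.partIn (P 0) Set.univ).Nonempty := fun p => hL p.1 ▸ p.2
  have hT := fun p => corays_partTuple_le hP (h0 p)
  have hF := fun p => rays_partTuple_le hP hP' (h0 p)
  have hTF := fun p => eq_extClosure_of_le hP' (partTuple_isComplete hP (h0 p)) (hT p) (hF p)
  let Φ : {p : TorsionPair (IsOrdinary K (CyclicQuiver n)) // (L p).Nonempty} →
      {S : PartTuple (CyclicQuiver n) // S.IsComplete ∧ Q S ∧ (S.part 0).Nonempty} := fun p =>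
    ⟨p.1.partTuple hP (h0 p), partTuple_isComplete hP (h0 p),
      (hQ _).2 (partTuple_isStrong hP hP' (h0 p)), h0 p⟩
  have hΦ : Function.Bijective Φ := by
    constructor
    · intro p q hpq
      have h : p.1.partTuple hP (h0 p) = q.1.partTuple hP (h0 q) := congrArg Subtype.val hpq
      refine Subtype.ext (ext_of_eq ?_ ?_)
      · rw [(hTF p).1, (hTF q).1, h]
      · rw [(hTF p).2, (hTF q).2, h]
    · rintro ⟨S, hS, hs, hne⟩
      rw [hQ] at hs
      let q : TorsionPair (IsOrdinary K (CyclicQuiver n)) := S.torsionPair hP' hS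
      have hqT : S.corays K P ≤ q.T := fun X hX => .of X hX
      have hqF : S.rays K P' ≤ q.F := fun X hX => .of X hX
      have hpart := part_eq_partIn hP hP' hS hs hne hqT hqF
      have hrest : S.rest 0 = Set.univ :=
        Set.eq_univ_of_forall fun v i hi => absurd hi (Fin.not_lt_zero i)
      have hq : (L q).Nonempty := by
        have := hpart 0
        rw [hrest] at this
        rw [hL]
        exact this ▸ hne
      -- S and the tuple built from q both satisfy the greedy recursion for q, which determines a
      -- complete tuple.
      refine ⟨⟨q, hq⟩, Subtype.ext (partTuple_unique (p := q) (P := P)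
        (partTuple_isComplete hP (h0 ⟨q, hq⟩)) hS (fun j => ?_) hpart)⟩
      have : (q.partTuple hP (h0 ⟨q, hq⟩)).rest j = q.restSeq P j :=
        partTuple_restNat hP (h0 ⟨q, hq⟩) j j.isLt.le
      rw [show (Φ ⟨q, hq⟩).1.rest j = q.restSeq P j from this]
      rfl
  exact ⟨Equiv.ofBijective Φ hΦ, fun p => ⟨(hL p.1).symm, hTF p⟩⟩

end TorsionPair
end QuiverTorsion

-- Both halves are one statement in which P marks the torsion indices: even ones in the first half,
-- odd ones in the second. So step 0 tests corays against T, giving L_T, or rays against F, giving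
-- R_F.
open QuiverTorsion in
theorem theorem4p15 (K : Type*) [Field K] (n : ℕ) [NeZero n] :
    (∃ Φ : {p : TorsionPair (IsOrdinary K (CyclicQuiver n)) // (leftVertices p.T).Nonempty} ≃
        {S : PartTuple (CyclicQuiver n) //
          S.IsComplete ∧ S.IsStrongOne ∧ (S.part 0).Nonempty},
      ∀ p, (Φ p).1.part 0 = leftVertices p.1.T ∧
        p.1.T = ExtClosure ((Φ p).1.corays K Even) ∧
        p.1.F = ExtClosure ((Φ p).1.rays K Odd)) ∧
    (∃ Ψ : {p : TorsionPair (IsOrdinary K (CyclicQuiver n)) // (rightVertices p.F).Nonempty} ≃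
        {S : PartTuple (CyclicQuiver n) //
          S.IsComplete ∧ S.IsStrongTwo ∧ (S.part 0).Nonempty},
      ∀ p, (Ψ p).1.part 0 = rightVertices p.1.F ∧
        p.1.T = ExtClosure ((Ψ p).1.corays K Odd) ∧
        p.1.F = ExtClosure ((Ψ p).1.rays K Even)) := by
  constructor
  · refine TorsionPair.exists_equiv_partTuple (P := Even) (P' := Odd)
      (fun j => Nat.even_add_one) (fun j => Nat.not_even_iff_odd.symm)
      (fun p => leftVertices p.T) (fun p => Set.ext fun v => ?_) _ (fun S => Iff.rfl)
    rw [TorsionPair.mem_leftVertices_iff, TorsionPair.mem_partIn_of_pos Even.zero]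
    simp
  · refine TorsionPair.exists_equiv_partTuple (P := Odd) (P' := Even)
      (fun j => Nat.odd_add_one) (fun j => Nat.not_odd_iff_even.symm)
      (fun p => rightVertices p.F) (fun p => Set.ext fun v => ?_) _
      (fun S => forall₂_congr fun _ _ => and_comm)
    rw [TorsionPair.mem_rightVertices_iff, TorsionPair.mem_partIn_of_neg (by simp)]
    simp
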